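/- For every $\delta>0$ there are an $\varepsilon>0$ and a randomized polynomial-time algorithm with the following property. The input is a family $\mathcal S=(S_1,\dots,S_n)$ of $n$ subsets of a finite universe $U$, and the running time is at most a fixed polynomial in $n+|U|$, for every input and every outcome of the coin tosses. The algorithm always outputs a set $T\subseteq\{1,\dots,n\}$ of indices together with subsets $A_i\subseteq S_i$ $(i\in T)$ that are pairwise disjoint and satisfy $|A_i|\ge\varepsilon|S_i|$ for every $i\in T$. Whenever some $m$ sets of $\mathcal S$ form a partition of $U$ (that is, they are nonempty and pairwise disjoint, and their union is $U$), the number $|T|$ of sets found is at least $(1-\delta)m$ with probability at least $2/3$, and also $\mathbb E\,|T|\ge(1-\delta)m$. The number $m$ is not part of the input. (Algorithms are programs of a unit-cost random access machine with addition, truncated subtraction and fair coin tosses; the program and the polynomial depend only on $\delta$.) -/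

import Mathlib

open MeasureTheory

/-! ### A randomized random access machine with unit-cost steps

Registers and memory cells hold natural numbers.  The only arithmetic operations are addition and
truncated subtraction, so that `t` steps increase the bit length of the stored numbers by at most
`t` and the unit-cost step count is polynomially related to Turing machine time. -/

namespace RAM

/-- Programs.  `x y z` are names of registers and `a` is the name of a two-dimensional array; both
kinds of name are fixed in the program text, while the indices into an array are register contents.
-/
inductive Cmd : Type
  /-- `x := k` for a constant `k` -/
  | const (x k : ℕ)
  /-- `x := y + z` -/
  | add (x y z : ℕ)
  /-- `x := max (y - z) 0` -/
  | sub (x y z : ℕ)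
  /-- `x := a[y, z]` -/
  | load (x a y z : ℕ)
  /-- `a[y, z] := x` -/
  | store (a y z x : ℕ)
  /-- `x :=` the outcome (`0` or `1`) of the next coin toss -/
  | flip (x : ℕ)
  /-- do nothing -/
  | skip
  /-- first `c`, then `d` -/
  | seq (c d : Cmd)
  /-- if `x ≠ 0` then `c` else `d` -/
  | ite (x : ℕ) (c d : Cmd)
  /-- while `x ≠ 0` do `c` -/
  | loop (x : ℕ) (c : Cmd)

/-- The data of the machine: registers, arrays, and the coin tosses not yet used. -/
structure State : Type where
  reg : ℕ → ℕ
  mem : ℕ → ℕ → ℕ → ℕ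
  coins : ℕ → Bool

/-- Write `v` into register `x`. -/
def State.setReg (s : State) (x v : ℕ) : State :=
  { s with reg := Function.update s.reg x v }

/-- Write `v` into the cell `a[i, j]`. -/
def State.setMem (s : State) (a i j v : ℕ) : State :=
  { s with mem := fun a' i' j' => if a' = a ∧ i' = i ∧ j' = j then v else s.mem a' i' j' }

/-- A configuration: the commands still to be executed, in this order, and the data. -/
structure Cfg : Type where
  code : List Cmd
  state : State

/-- One step of the machine; a configuration with no command left has halted and is not changed. -/
def step : Cfg → Cfg
  | ⟨[], s⟩ => ⟨[], s⟩
  | ⟨.const x k :: r, s⟩ => ⟨r, s.setReg x k⟩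
  | ⟨.add x y z :: r, s⟩ => ⟨r, s.setReg x (s.reg y + s.reg z)⟩
  | ⟨.sub x y z :: r, s⟩ => ⟨r, s.setReg x (s.reg y - s.reg z)⟩
  | ⟨.load x a y z :: r, s⟩ => ⟨r, s.setReg x (s.mem a (s.reg y) (s.reg z))⟩
  | ⟨.store a y z x :: r, s⟩ => ⟨r, s.setMem a (s.reg y) (s.reg z) (s.reg x)⟩
  | ⟨.flip x :: r, s⟩ =>
      ⟨r, { s.setReg x (if s.coins 0 then 1 else 0) with coins := fun i => s.coins (i + 1) }⟩
  | ⟨.skip :: r, s⟩ => ⟨r, s⟩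
  | ⟨.seq c d :: r, s⟩ => ⟨c :: d :: r, s⟩
  | ⟨.ite x c d :: r, s⟩ => if s.reg x ≠ 0 then ⟨c :: r, s⟩ else ⟨d :: r, s⟩
  | ⟨.loop x c :: r, s⟩ => if s.reg x ≠ 0 then ⟨c :: .loop x c :: r, s⟩ else ⟨r, s⟩

/-- The configuration after `t` steps of the program `P` started on the data `s`. -/
def run (P : Cmd) (s : State) (t : ℕ) : Cfg := step^[t] ⟨[P], s⟩

/-- The law of an infinite sequence of independent fair coin tosses. -/
noncomputable def fairCoins : Measure (ℕ → Bool) :=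
  Measure.infinitePi fun _ => (PMF.uniformOfFintype Bool).toMeasure

end RAM

/-! ### Set packing

An instance is a family `S` of `n` sets over the universe `Fin N`. -/

namespace SetPacking

variable {n N : ℕ}

/-- The initial data on input `S` and coin tosses `ω`: `n` in register `0`, `N` in register `1`,
and the incidence matrix of the family in array `0`. -/
def input (S : Fin n → Finset (Fin N)) (ω : ℕ → Bool) : RAM.State where
  reg x := if x = 0 then n else if x = 1 then N else 0
  mem a i j := if a = 0 ∧ ∃ (hi : i < n) (hj : j < N), (⟨j, hj⟩ : Fin N) ∈ S ⟨i, hi⟩ then 1 else 0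
  coins := ω

/-- The data after `t` steps of the program `P` on input `S` with coin tosses `ω`. -/
def final (P : RAM.Cmd) (S : Fin n → Finset (Fin N)) (t : ℕ) (ω : ℕ → Bool) : RAM.State :=
  (RAM.run P (input S ω) t).state

/-- The indices of the selected sets, as read off the data `s`:
the `i` whose entry `[i, 0]` in array `1` is not zero. -/
def selected (n : ℕ) (s : RAM.State) : Finset (Fin n) := {i | s.mem 1 i 0 ≠ 0}

/-- The subset `A i`, as read off the data `s`:
the `j` whose entry `[i, j]` in array `2` is not zero. -/
def part (N : ℕ) (s : RAM.State) (i : ℕ) : Finset (Fin N) := {j | s.mem 2 i j ≠ 0}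

/-- Some `m` sets of the family form a partition of the universe: they are nonempty and pairwise
disjoint, and they cover everything. -/
def HasPartition (S : Fin n → Finset (Fin N)) (m : ℕ) : Prop :=
  ∃ I : Finset (Fin n), I.card = m ∧ (∀ i ∈ I, (S i).Nonempty) ∧
    (I : Set (Fin n)).PairwiseDisjoint S ∧ I.biUnion S = Finset.univ

/-- The sets `S i`, `i ∈ T`, together with the subsets `A i` form an `ε`-partial packing. -/
def IsPartialPacking (S : Fin n → Finset (Fin N)) (ε : ℝ) (T : Finset (Fin n))
    (A : Fin n → Finset (Fin N)) : Prop :=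
  (∀ i ∈ T, A i ⊆ S i ∧ ε * ((S i).card : ℝ) ≤ ((A i).card : ℝ)) ∧
    (T : Set (Fin n)).PairwiseDisjoint A

end SetPacking

/-! The algorithm is deterministic. Fix `B > 2/δ`, `K = 2(B+1)` and `ε = 1/K`, and call a set small
if it has at most `K` elements.

A small set meets its quota with one element, so the small sets pose a bipartite matching problem.
It is solved approximately by an auction with integer prices up to `B`: an unselected set that finds
an element cheaper than `B` takes a cheapest one, evicts its owner and raises the price by one. The
price sum is at most `B * N` and grows with every purchase, so `1 + B * N` rounds suffice. Prices
and winners' surpluses form a dual solution, and `auction_duality` shows that `B` times the number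
of small sets in a disjoint family is at most `B + 1` times the number of winners.

Large sets are then treated by increasing size. A set is selected if at least a `1/K` fraction of it
is free, and it takes just enough free elements. A rejected set is mostly occupied by sets that are
not larger. If every selected set spreads weight one over its part, a rejected set receives weight
at least `B`; hence `B` times the number of rejected sets in a disjoint family is at most the number
of selected sets (`greedy_charge`).

Adding the two estimates gives `B * m ≤ (B + 2) * |T|` (`GreedyInv.bound`), which is enough by the
choice of `B`. The rest is program verification: a time-bounded Hoare calculus, a rule for counting
loops, and the invariants `AuctionInv` and `GreedyInv`. As no coin is tossed, the bound holds
surely, hence with probability one and in expectation. -/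

namespace RAM

/-! ### Total correctness with a time bound -/

/-- Started on the data `s`, the command `c` is completed within `t` steps, and the resulting data
satisfy `Q`. -/
def WP (t : ℕ) (c : Cmd) (s : State) (Q : State → Prop) : Prop :=
  ∃ t' ≤ t, ∃ s', Q s' ∧ ∀ r, step^[t'] ⟨c :: r, s⟩ = ⟨r, s'⟩

theorem WP.mono {t u : ℕ} {c : Cmd} {s : State} {Q Q' : State → Prop} (h : WP t c s Q)
    (htu : t ≤ u) (hQ : ∀ s', Q s' → Q' s') : WP u c s Q' := by
  obtain ⟨t', ht', s', hs', hr⟩ := h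
  exact ⟨t', ht'.trans htu, s', hQ _ hs', hr⟩

theorem WP.const {t x k : ℕ} {s : State} {Q : State → Prop} (ht : 1 ≤ t)
    (h : Q (s.setReg x k)) : WP t (.const x k) s Q := ⟨1, ht, _, h, fun _ => rfl⟩

theorem WP.add {t x y z : ℕ} {s : State} {Q : State → Prop} (ht : 1 ≤ t)
    (h : Q (s.setReg x (s.reg y + s.reg z))) : WP t (.add x y z) s Q :=
  ⟨1, ht, _, h, fun _ => rfl⟩

theorem WP.sub {t x y z : ℕ} {s : State} {Q : State → Prop} (ht : 1 ≤ t)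
    (h : Q (s.setReg x (s.reg y - s.reg z))) : WP t (.sub x y z) s Q :=
  ⟨1, ht, _, h, fun _ => rfl⟩

theorem WP.load {t x a y z : ℕ} {s : State} {Q : State → Prop} (ht : 1 ≤ t)
    (h : Q (s.setReg x (s.mem a (s.reg y) (s.reg z)))) : WP t (.load x a y z) s Q :=
  ⟨1, ht, _, h, fun _ => rfl⟩

theorem WP.store {t x a y z : ℕ} {s : State} {Q : State → Prop} (ht : 1 ≤ t)
    (h : Q (s.setMem a (s.reg y) (s.reg z) (s.reg x))) : WP t (.store a y z x) s Q :=
  ⟨1, ht, _, h, fun _ => rfl⟩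

theorem WP.skip {t : ℕ} {s : State} {Q : State → Prop} (ht : 1 ≤ t) (h : Q s) :
    WP t .skip s Q := ⟨1, ht, _, h, fun _ => rfl⟩

theorem WP.seq {t a b : ℕ} {c d : Cmd} {s : State} {Q : State → Prop}
    (h : WP a c s fun s' => WP b d s' Q) (ht : a + b + 1 ≤ t) : WP t (.seq c d) s Q := by
  obtain ⟨t₁, h₁, s₁, ⟨t₂, h₂, s₂, hQ, hr₂⟩, hr₁⟩ := h
  refine ⟨t₂ + (t₁ + 1), by omega, s₂, hQ, fun r => ?_⟩
  rw [Function.iterate_add_apply, Function.iterate_succ_apply]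
  exact (congrArg _ (hr₁ (d :: r))).trans (hr₂ r)

theorem WP.ite {t a x : ℕ} {c d : Cmd} {s : State} {Q : State → Prop}
    (h₁ : s.reg x ≠ 0 → WP a c s Q) (h₂ : s.reg x = 0 → WP a d s Q) (ht : a + 1 ≤ t) :
    WP t (.ite x c d) s Q := by
  by_cases hx : s.reg x = 0
  · obtain ⟨t', ht', s', hQ, hr⟩ := h₂ hx
    refine ⟨t' + 1, by omega, s', hQ, fun r => ?_⟩
    rw [Function.iterate_succ_apply, ← hr r]
    simp [step, hx]
  · obtain ⟨t', ht', s', hQ, hr⟩ := h₁ hx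
    refine ⟨t' + 1, by omega, s', hQ, fun r => ?_⟩
    rw [Function.iterate_succ_apply, ← hr r]
    simp [step, hx]

theorem WP.loop_done {t x : ℕ} {c : Cmd} {s : State} {Q : State → Prop} (hx : s.reg x = 0)
    (ht : 1 ≤ t) (h : Q s) : WP t (.loop x c) s Q :=
  ⟨1, ht, s, h, fun r => by simp [step, hx]⟩

theorem WP.loop_step {t a b x : ℕ} {c : Cmd} {s : State} {Q : State → Prop} (hx : s.reg x ≠ 0)
    (h : WP a c s fun s' => WP b (.loop x c) s' Q) (ht : a + b + 1 ≤ t) :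
    WP t (.loop x c) s Q := by
  obtain ⟨t₁, h₁, s₁, ⟨t₂, h₂, s₂, hQ, hr₂⟩, hr₁⟩ := h
  refine ⟨t₂ + (t₁ + 1), by omega, s₂, hQ, fun r => ?_⟩
  rw [Function.iterate_add_apply, Function.iterate_succ_apply, ← hr₂ r, ← hr₁ _]
  simp [step, hx]

/-! ### Frame conditions -/

/-- The registers that a command may change. -/
def Cmd.writes : Cmd → List ℕ
  | .const x _ | .add x _ _ | .sub x _ _ | .load x _ _ _ | .flip x => [x]
  | .store _ _ _ _ | .skip => []
  | .seq c d | .ite _ c d => c.writes ++ d.writes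
  | .loop _ c => c.writes

/-- The arrays that a command may change. -/
def Cmd.stores : Cmd → List ℕ
  | .store a _ _ _ => [a]
  | .const _ _ | .add _ _ _ | .sub _ _ _ | .load _ _ _ _ | .flip _ | .skip => []
  | .seq c d | .ite _ c d => c.stores ++ d.stores
  | .loop _ c => c.stores

/-- The condition concerns all pending code, since a step may unfold a compound command into its
pieces; this makes it inductive. -/
theorem step_reg {x : ℕ} (C : Cfg) (h : ∀ c ∈ C.code, x ∉ c.writes) :
    (step C).state.reg x = C.state.reg x ∧ ∀ c ∈ (step C).code, x ∉ c.writes := by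
  obtain ⟨code, s⟩ := C
  cases code with
  | nil => simp [step]
  | cons c r =>
    cases c <;> simp only [step] <;>
      first
      | (split_ifs <;> simp_all [Cmd.writes, State.setReg])
      | simp_all [Cmd.writes, State.setReg, State.setMem]

theorem step_mem {a : ℕ} (C : Cfg) (h : ∀ c ∈ C.code, a ∉ c.stores) :
    (step C).state.mem a = C.state.mem a ∧ ∀ c ∈ (step C).code, a ∉ c.stores := by
  obtain ⟨code, s⟩ := C
  cases code with
  | nil => simp [step]
  | cons c r =>
    cases c <;> simp only [step] <;>
      first
      | (split_ifs <;> simp_all [Cmd.stores, State.setReg])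
      | simp_all [Cmd.stores, State.setReg, State.setMem]

theorem iterate_step_reg {x : ℕ} (t : ℕ) (C : Cfg) (h : ∀ c ∈ C.code, x ∉ c.writes) :
    (step^[t] C).state.reg x = C.state.reg x := by
  induction t generalizing C with
  | zero => rfl
  | succ t ih =>
    rw [Function.iterate_succ_apply, ih _ (step_reg C h).2, (step_reg C h).1]

theorem iterate_step_mem {a : ℕ} (t : ℕ) (C : Cfg) (h : ∀ c ∈ C.code, a ∉ c.stores) :
    (step^[t] C).state.mem a = C.state.mem a := by
  induction t generalizing C with
  | zero => rfl
  | succ t ih =>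
    rw [Function.iterate_succ_apply, ih _ (step_mem C h).2, (step_mem C h).1]

/-- The data `s'` differ from `s` only where the command `c` may write. -/
structure Frame (c : Cmd) (s s' : State) : Prop where
  reg : ∀ x, x ∉ c.writes → s'.reg x = s.reg x
  mem : ∀ a, a ∉ c.stores → s'.mem a = s.mem a

/-- Since `writes` and `stores` are computable lists, each use needs only a decidable membership
check. Postconditions can therefore mention only what a subroutine changes. -/
theorem WP.frame {t : ℕ} {c : Cmd} {s : State} {Q : State → Prop} (h : WP t c s Q) :
    WP t c s fun s' => Q s' ∧ Frame c s s' := by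
  obtain ⟨t', ht', s', hQ, hr⟩ := h
  refine ⟨t', ht', s', ⟨hQ, fun x hx => ?_, fun a ha => ?_⟩, hr⟩
  · have := iterate_step_reg (x := x) t' ⟨[c], s⟩ (by simpa using hx)
    rwa [hr []] at this
  · have := iterate_step_mem (a := a) t' ⟨[c], s⟩ (by simpa using ha)
    rwa [hr []] at this

/-! ### Counting loops -/

/-- `for i = 0, …, b - 1 do body`, where `b` is the content of the register `b`.  The register `c`
is auxiliary, and register `2` has to contain `1`. -/
def forTo (i c b : ℕ) (body : Cmd) : Cmd :=
  .seq (.const i 0) (.seq (.sub c b i)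
    (.loop c (.seq body (.seq (.add i i 2) (.sub c b i)))))

/-- The control register holds `L - k`, so the loop ends after exactly `L` rounds. `hstable` is
needed because the loop itself overwrites `i` and `c` between rounds. The bound `M` replaces `L` in
the time, so that all costs can be expressed through one size parameter. -/
theorem WP.forTo {i c b L M t u : ℕ} {body : Cmd} {s : State} (Inv : ℕ → State → Prop)
    (hb : s.reg b = L) (hone : s.reg 2 = 1) (hLM : L ≤ M)
    (hw : i ∉ body.writes ∧ b ∉ body.writes ∧ 2 ∉ body.writes)
    (hne : i ≠ c ∧ i ≠ b ∧ i ≠ 2 ∧ c ≠ b ∧ c ≠ 2)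
    (hstable : ∀ k s v w, Inv k s → Inv k ((s.setReg i v).setReg c w))
    (hinit : Inv 0 s)
    (hbody : ∀ k s', k < L → (∀ x, x ∉ body.writes → x ≠ i → x ≠ c → s'.reg x = s.reg x) →
      (∀ a, a ∉ body.stores → s'.mem a = s.mem a) → s'.reg i = k → Inv k s' →
      WP t body s' (Inv (k + 1)))
    (hu : M * (t + 5) + 5 ≤ u) :
    WP u (forTo i c b body) s (Inv L) := by
  obtain ⟨hwi, hwb, hw2⟩ := hw
  obtain ⟨hic, hib, hi2, hcb, hc2⟩ := hne
  have key : ∀ (d k : ℕ) (s' : State), k + d = L →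
      (∀ x, x ∉ body.writes → x ≠ i → x ≠ c → s'.reg x = s.reg x) →
      (∀ a, a ∉ body.stores → s'.mem a = s.mem a) → s'.reg i = k → s'.reg c = L - k → Inv k s' →
      WP (d * (t + 5) + 1) (.loop c (.seq body (.seq (.add i i 2) (.sub c b i)))) s' (Inv L) := by
    intro d
    induction d with
    | zero =>
      intro k s' hk _ _ _ hc hI
      obtain rfl : k = L := by omega
      exact WP.loop_done (by omega) (by omega) hI
    | succ d ih =>
      intro k s' hk hreg hmem hi hc hI
      -- Besides the body, a round costs five steps: the loop test, two `seq`, the increment and the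
      -- recomputation of `c`.
      refine WP.loop_step (a := t + 4) (b := d * (t + 5) + 1) (by omega) ?_ (by ring_nf; omega)
      refine WP.seq (a := t) (b := 3) ?_ (by omega)
      refine (hbody k s' (by omega) hreg hmem hi hI).frame.mono le_rfl ?_
      rintro s₁ ⟨hI₁, hf⟩
      refine WP.seq (a := 1) (b := 1) (WP.add le_rfl (WP.sub le_rfl ?_)) le_rfl
      have hi₁ : s₁.reg i = k := (hf.reg i hwi).trans hi
      have hb₁ : s₁.reg b = L :=
        (hf.reg b hwb).trans ((hreg b hwb hib.symm hcb.symm).trans hb)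
      have h2₁ : s₁.reg 2 = 1 :=
        (hf.reg 2 hw2).trans ((hreg 2 hw2 hi2.symm hc2.symm).trans hone)
      refine ih (k + 1) _ (by omega) ?_ ?_ ?_ ?_ (hstable _ _ _ _ hI₁)
      · intro x hx hxi hxc
        simp [State.setReg, hxi, hxc, hf.reg x hx, hreg x hx hxi hxc]
      · intro a ha
        simp [State.setReg, hf.mem a ha, hmem a ha]
      · simp [State.setReg, hic, hi₁, h2₁]
      · simp [State.setReg, hib.symm, hi₁, h2₁, hb₁]
  have hle : L * (t + 5) ≤ M * (t + 5) := Nat.mul_le_mul_right _ hLM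
  refine WP.seq (a := 1) (b := L * (t + 5) + 3) (WP.const le_rfl ?_) (by omega)
  refine WP.seq (a := 1) (b := L * (t + 5) + 1) (WP.sub le_rfl ?_) (by omega)
  refine key L 0 _ (by omega) ?_ ?_ ?_ ?_ (hstable _ _ _ _ hinit)
  · intro x _ hxi hxc
    simp [State.setReg, hxi, hxc]
  · intro a _
    simp [State.setReg]
  · simp [State.setReg, hic]
  · simp [State.setReg, hib.symm, hb]

/-! ### Programs without coin tosses -/

/-- The command tosses no coin. -/
def Cmd.NoFlip : Cmd → Prop
  | .flip _ => False
  | .store _ _ _ _ | .const _ _ | .add _ _ _ | .sub _ _ _ | .load _ _ _ _ | .skip => True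
  | .seq c d | .ite _ c d => c.NoFlip ∧ d.NoFlip
  | .loop _ c => c.NoFlip

/-- Only `flip` reads the coins, so replacing them commutes with a step. -/
theorem step_coins (ω : ℕ → Bool) (C : Cfg) (h : ∀ c ∈ C.code, c.NoFlip) :
    step ⟨C.code, { C.state with coins := ω }⟩ =
      ⟨(step C).code, { (step C).state with coins := ω }⟩ ∧ ∀ c ∈ (step C).code, c.NoFlip := by
  obtain ⟨code, s⟩ := C
  cases code with
  | nil => simp [step]
  | cons c r =>
    cases c <;> simp only [step] <;>
      first
      | (split_ifs <;> simp_all [Cmd.NoFlip])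
      | simp_all [Cmd.NoFlip, State.setReg, State.setMem]

theorem iterate_step_coins (ω : ℕ → Bool) (t : ℕ) (C : Cfg) (h : ∀ c ∈ C.code, c.NoFlip) :
    step^[t] ⟨C.code, { C.state with coins := ω }⟩ =
      ⟨(step^[t] C).code, { (step^[t] C).state with coins := ω }⟩ := by
  induction t generalizing C with
  | zero => rfl
  | succ t ih =>
    rw [Function.iterate_succ_apply, Function.iterate_succ_apply, (step_coins ω C h).1,
      ih _ (step_coins ω C h).2]

theorem iterate_step_halted (t : ℕ) (s : State) : step^[t] ⟨[], s⟩ = ⟨[], s⟩ := by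
  induction t with
  | zero => rfl
  | succ t ih => rw [Function.iterate_succ_apply]; exact ih

/-- A halted configuration is a fixed point of `step`, so completion within `t` steps determines the
configuration at time exactly `t`. -/
theorem WP.run {t : ℕ} {c : Cmd} {s : State} {Q : State → Prop} (h : WP t c s Q) :
    (run c s t).code = [] ∧ Q (run c s t).state := by
  obtain ⟨t', ht', s', hQ, hr⟩ := h
  have : RAM.run c s t = ⟨[], s'⟩ := by
    rw [RAM.run, ← Nat.sub_add_cancel ht', Function.iterate_add_apply, hr [], iterate_step_halted]
  rw [this]
  exact ⟨rfl, hQ⟩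

instance : IsProbabilityMeasure fairCoins := by
  unfold fairCoins
  infer_instance

end RAM

/-! ### Combinatorial bounds: duality for the auction, charging for the greedy choice -/

namespace SetPacking

open Finset

/-- Weak duality for an auction with prices between `0` and `B`, in which every winner `t ∈ T` holds
an element `g t` that is cheapest up to one unit, exactly the elements held have a positive price,
and the losers cannot afford any of their elements. -/
theorem auction_duality {E : ℕ → Finset ℕ} {B : ℕ} {price g : ℕ → ℕ} {T I : Finset ℕ}
    (hB : ∀ j, price j ≤ B) (hginj : Set.InjOn g T)
    (hpos : ∀ j, price j ≠ 0 → ∃ t ∈ T, g t = j)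
    (hmin : ∀ t ∈ T, ∀ j ∈ E t, price (g t) ≤ price j + 1)
    (hlose : ∀ i ∈ I, i ∉ T → ∀ j ∈ E i, B ≤ price j)
    (hne : ∀ i ∈ I, (E i).Nonempty) (hdisj : (I : Set ℕ).PairwiseDisjoint E) :
    B * I.card ≤ (B + 1) * T.card := by
  classical
  choose! h hh using hne
  have hinj : Set.InjOn h I := by
    intro a ha b hb hab
    by_contra hne
    exact (Finset.disjoint_left.1 (hdisj ha hb hne) (hh a ha)) (hab ▸ hh b hb)
  -- Dual feasibility: the price of the chosen element `h i`, plus the surplus `B + 1 - price (g i)`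
  -- of a winner, is at least `B`.
  have h1 : B * I.card ≤ ∑ i ∈ I, (price (h i) + if i ∈ T then B + 1 - price (g i) else 0) := by
    rw [mul_comm, ← smul_eq_mul]
    refine Finset.card_nsmul_le_sum _ _ _ fun i hi => ?_
    split_ifs with hT
    · have := hmin i hT _ (hh i hi)
      omega
    · exact hlose i hi hT _ (hh i hi)
  -- The `h i` are distinct by disjointness, and every positive price belongs to an element held by
  -- a winner.
  have h2 : ∑ i ∈ I, price (h i) ≤ ∑ t ∈ T, price (g t) := by
    rw [← Finset.sum_image (f := price) hinj, ← Finset.sum_image (f := price) hginj]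
    refine Finset.sum_le_sum_of_ne_zero fun j _ hj => ?_
    obtain ⟨t, ht, rfl⟩ := hpos j hj
    exact Finset.mem_image_of_mem _ ht
  have h3 : ∑ i ∈ I, (if i ∈ T then B + 1 - price (g i) else 0) ≤
      ∑ t ∈ T, (B + 1 - price (g t)) := by
    rw [← Finset.sum_filter]
    exact Finset.sum_le_sum_of_subset fun i hi => (Finset.mem_filter.1 hi).2
  have h4 : ∑ t ∈ T, price (g t) + ∑ t ∈ T, (B + 1 - price (g t)) = (B + 1) * T.card := by
    rw [← Finset.sum_add_distrib, Finset.sum_congr rfl (g := fun _ => B + 1), Finset.sum_const,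
      smul_eq_mul, mul_comm]
    intro t _
    have := hB (g t)
    omega
  rw [Finset.sum_add_distrib] at h1
  omega

/-- Sets rejected by the greedy rule are few: if all but a `1 / K` fraction of every set `E i`,
`i ∈ R`, is occupied by chosen sets that are not larger, each of which occupies about a `1 / K`
fraction of itself, then the disjoint family `R` is small compared with the chosen family `T`. -/
theorem greedy_charge {E A : ℕ → Finset ℕ} {B K : ℕ} {T R : Finset ℕ} (hK : K = 2 * (B + 1))
    (hA : ∀ t ∈ T, K * (A t).card < (E t).card + K)
    (hR : ∀ i ∈ R, K < (E i).card ∧ K * (E i).card < K * ((E i).filter fun j =>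
      ∃ t ∈ T, j ∈ A t ∧ (E t).card ≤ (E i).card).card + (E i).card)
    (hdisj : (R : Set ℕ).PairwiseDisjoint E) :
    B * R.card ≤ T.card := by
  classical
  -- Each `t ∈ T` spreads a total weight of one evenly over `A t` (weight zero if `A t` is empty).
  set w : ℕ → ℚ := fun j => ∑ t ∈ T, if j ∈ A t then ((A t).card : ℚ)⁻¹ else 0 with hw
  have hw0 : ∀ j, 0 ≤ w j := fun j => Finset.sum_nonneg fun t _ => by split_ifs <;> positivity
  have htot : ∑ j ∈ R.biUnion E, w j ≤ T.card := by
    rw [hw, Finset.sum_comm, Finset.card_eq_sum_ones, Nat.cast_sum]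
    refine Finset.sum_le_sum fun t _ => ?_
    rw [← Finset.sum_filter, Finset.sum_const, nsmul_eq_mul, Nat.cast_one]
    have hle : (((R.biUnion E).filter fun j => j ∈ A t).card : ℚ) ≤ (A t).card := by
      exact_mod_cast Finset.card_le_card fun j hj => (Finset.mem_filter.1 hj).2
    exact (mul_le_mul_of_nonneg_right hle (by positivity)).trans mul_inv_le_one
  have hone : ∀ i ∈ R, (B : ℚ) ≤ ∑ j ∈ E i, w j := by
    intro i hi
    obtain ⟨hKi, hocc⟩ := hR i hi
    set O := (E i).filter fun j => ∃ t ∈ T, j ∈ A t ∧ (E t).card ≤ (E i).card with hO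
    have hEpos : (0 : ℚ) < (E i).card := by exact_mod_cast (by omega : 0 < (E i).card)
    have hwj : ∀ j ∈ O, ((B + 1 : ℕ) : ℚ) / (E i).card ≤ w j := by
      intro j hj
      obtain ⟨t, ht, hjt, hle⟩ := (Finset.mem_filter.1 hj).2
      have hpos : 0 < (A t).card := Finset.card_pos.2 ⟨j, hjt⟩
      -- `K * |A t| < |E t| + K ≤ |E i| + K < 2 * |E i|`, and `K = 2(B+1)`.
      have hlt : (B + 1) * (A t).card ≤ (E i).card := by
        have := hA t ht
        rw [hK] at this hKi
        nlinarith
      calc ((B + 1 : ℕ) : ℚ) / (E i).card ≤ ((A t).card : ℚ)⁻¹ := by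
            rw [div_le_iff₀ hEpos, inv_mul_eq_div, le_div_iff₀ (by exact_mod_cast hpos)]
            exact_mod_cast hlt
        _ = if j ∈ A t then ((A t).card : ℚ)⁻¹ else 0 := by rw [if_pos hjt]
        _ ≤ w j := Finset.single_le_sum
            (f := fun t => if j ∈ A t then ((A t).card : ℚ)⁻¹ else 0)
            (fun t _ => by split_ifs <;> positivity) ht
    have hsum : (O.card : ℚ) * (((B + 1 : ℕ) : ℚ) / (E i).card) ≤ ∑ j ∈ E i, w j := by
      rw [← nsmul_eq_mul]
      refine (Finset.card_nsmul_le_sum _ _ _ hwj).trans ?_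
      exact Finset.sum_le_sum_of_subset_of_nonneg (Finset.filter_subset _ _) fun j _ _ => hw0 j
    refine le_trans ?_ hsum
    rw [← mul_div_assoc, le_div_iff₀ hEpos]
    -- The occupied fraction exceeds `1 - 1/K`, and `(B + 1) * (1 - 1/K) = B + 1/2`.
    have : B * (E i).card ≤ O.card * (B + 1) := by
      rw [hK] at hocc
      nlinarith
    exact_mod_cast this
  have : (B : ℚ) * R.card ≤ T.card := by
    refine le_trans ?_ htot
    rw [Finset.sum_biUnion hdisj, mul_comm, ← nsmul_eq_mul]
    exact Finset.card_nsmul_le_sum _ _ _ hone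
  exact_mod_cast this

end SetPacking

namespace SetPacking

open Finset RAM

/-! ### The program

Array `1` holds the selection and array `2` the parts.  Array `3` holds the owner of an element and
array `4` its price; an element is free if its price is `0`. -/

/-- Put the size of set number `reg 6` into register `10`. -/
def sizeCmd : Cmd :=
  .seq (.const 10 0) (forTo 8 9 1 (.seq (.load 11 0 6 8) (.add 10 10 11)))

/-- Look for a cheapest element of set number `reg 6` with a price below `reg 5`. -/
def cheapestCmd : Cmd :=
  .seq (.add 12 5 3) (forTo 8 9 1 (.seq (.load 11 0 6 8)
    (.ite 11 (.seq (.load 14 4 8 3) (.seq (.sub 11 12 14)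
      (.ite 11 (.seq (.add 12 14 3) (.add 13 8 3)) .skip))) .skip)))

/-- Give element number `reg 13` of price `reg 12` to set number `reg 6`, evict the previous owner
if there is one, and raise the price. -/
def buyCmd : Cmd :=
  .seq (.ite 12 (.seq (.load 14 3 13 3) (.seq (.store 1 14 3 3) (.store 2 14 13 3))) .skip)
    (.seq (.add 12 12 2) (.seq (.store 4 13 3 12) (.seq (.store 3 13 3 6)
      (.seq (.store 1 6 3 2) (.store 2 6 13 2)))))

/-- If set number `reg 6` is small and not selected, then it buys a cheapest element. -/
def auctionStep : Cmd :=
  .seq sizeCmd (.seq (.sub 11 10 4) (.ite 11 .skip (.seq (.load 11 1 6 3) (.ite 11 .skip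
    (.seq cheapestCmd (.seq (.sub 11 5 12) (.ite 11 buyCmd .skip)))))))

/-- The auction for the small sets. -/
def auctionCmd : Cmd :=
  .seq (.seq (.const 15 1) (forTo 8 9 5 (.add 15 15 1)))
    (forTo 16 17 15 (forTo 6 7 0 auctionStep))

/-- Subtract `reg 4` from the size `reg 10` once for each free element of set number `reg 6`. -/
def countFreeCmd : Cmd :=
  .seq (.add 19 10 3) (forTo 8 9 1 (.seq (.load 11 0 6 8)
    (.ite 11 (.seq (.load 14 4 8 3) (.ite 14 .skip (.sub 19 19 4))) .skip)))

/-- Give a `1 / reg 4` fraction of set number `reg 6`, of size `reg 10`, to this set, as far as there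
are free elements. -/
def grabCmd : Cmd :=
  .seq (.add 19 10 3) (forTo 8 9 1 (.seq (.load 11 0 6 8)
    (.ite 11 (.seq (.load 14 4 8 3) (.ite 14 .skip
      (.ite 19 (.seq (.sub 19 19 4) (.seq (.store 4 8 3 2) (.store 2 6 8 2))) .skip))) .skip)))

/-- If set number `reg 6` has size `reg 16 + reg 4 + 1` and enough free elements, then select it. -/
def greedyStep : Cmd :=
  .seq sizeCmd (.seq (.add 18 16 4) (.seq (.add 18 18 2) (.seq (.sub 11 10 18) (.seq (.sub 14 18 10)
    (.seq (.add 11 11 14) (.ite 11 .skip (.seq countFreeCmd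
      (.ite 19 .skip (.seq grabCmd (.store 1 6 3 2))))))))))

/-- The greedy choice of large sets, in the order of their sizes. -/
def greedyCmd : Cmd := forTo 16 17 1 (forTo 6 7 0 greedyStep)

/-- The whole program. -/
def packCmd (K B : ℕ) : Cmd :=
  .seq (.const 2 1) (.seq (.const 3 0) (.seq (.const 4 K) (.seq (.const 5 B)
    (.seq auctionCmd greedyCmd))))

/-! ### Verification of the subroutines -/

theorem setReg_reg (s : State) (x v y : ℕ) :
    (s.setReg x v).reg y = if y = x then v else s.reg y := by
  simp [State.setReg, Function.update_apply]

theorem setReg_mem (s : State) (x v : ℕ) : (s.setReg x v).mem = s.mem := rfl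

theorem setMem_reg (s : State) (a i j v : ℕ) : (s.setMem a i j v).reg = s.reg := rfl

theorem setMem_mem (s : State) (a i j v a' i' j' : ℕ) : (s.setMem a i j v).mem a' i' j' =
    if a' = a ∧ i' = i ∧ j' = j then v else s.mem a' i' j' := rfl

/-- The input and the constants are in place. -/
structure Ctx (E : ℕ → Finset ℕ) (n N K B : ℕ) (s : State) : Prop where
  hn : s.reg 0 = n
  hN : s.reg 1 = N
  one : s.reg 2 = 1
  zero : s.reg 3 = 0
  hK : s.reg 4 = K
  hB : s.reg 5 = B
  inc : ∀ i j, s.mem 0 i j = if j ∈ E i then 1 else 0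
  sub : ∀ i, E i ⊆ range N

variable {E : ℕ → Finset ℕ} {n N K B M : ℕ} {s : State}

theorem Ctx.of_eq {s' : State} (h : Ctx E n N K B s) (hr : ∀ x < 6, s'.reg x = s.reg x)
    (hm : s'.mem 0 = s.mem 0) : Ctx E n N K B s' where
  hn := (hr 0 (by omega)).trans h.hn
  hN := (hr 1 (by omega)).trans h.hN
  one := (hr 2 (by omega)).trans h.one
  zero := (hr 3 (by omega)).trans h.zero
  hK := (hr 4 (by omega)).trans h.hK
  hB := (hr 5 (by omega)).trans h.hB
  inc := by rw [hm]; exact h.inc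
  sub := h.sub

theorem filter_lt_succ_of_mem {A : Finset ℕ} {k : ℕ} (h : k ∈ A) :
    (A.filter (· < k + 1)) = insert k (A.filter (· < k)) := by
  ext x; simp only [mem_filter, mem_insert]; grind

theorem filter_lt_succ_of_notMem {A : Finset ℕ} {k : ℕ} (h : k ∉ A) :
    (A.filter (· < k + 1)) = A.filter (· < k) := by
  ext x; simp only [mem_filter]; grind

theorem filter_lt_of_subset {A : Finset ℕ} (h : A ⊆ range N) : A.filter (· < N) = A :=
  filter_true_of_mem fun _ hx => mem_range.1 (h hx)

theorem wp_sizeCmd (h : Ctx E n N K B s) (hM : N ≤ M) :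
    WP (M * 8 + 7) sizeCmd s fun s' => s'.reg 10 = (E (s.reg 6)).card := by
  refine WP.seq (a := 1) (b := M * 8 + 5) (WP.const le_rfl ?_) (by omega)
  refine (WP.forTo (L := N) (M := M) (t := 3)
    (fun k s' => s'.reg 10 = ((E (s.reg 6)).filter (· < k)).card) ?_ ?_ hM (by decide) (by decide)
    ?_ ?_ ?_ le_rfl).mono le_rfl ?_
  · simpa [setReg_reg] using h.hN
  · simpa [setReg_reg] using h.one
  · intro k s v w hI
    simpa [setReg_reg] using hI
  · simp [setReg_reg]
  · intro k s' hk hr hm hi hI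
    have h6 : s'.reg 6 = s.reg 6 := hr 6 (by decide) (by decide) (by decide)
    have h0 : s'.mem 0 = s.mem 0 := hm 0 (by decide)
    refine WP.seq (a := 1) (b := 1) (WP.load le_rfl (WP.add le_rfl ?_)) le_rfl
    by_cases hkE : k ∈ E (s.reg 6)
    · rw [filter_lt_succ_of_mem hkE, card_insert_of_notMem (by simp)]
      simp [setReg_reg, h6, hi, h0, h.inc, hkE, hI]
    · rw [filter_lt_succ_of_notMem hkE]
      simp [setReg_reg, h6, hi, h0, h.inc, hkE, hI]
  · intro s' hI
    rw [hI, filter_lt_of_subset (h.sub _)]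

/-- Register `12` starts at `B` and falls only on strictly cheaper elements. A final value below `B`
thus certifies that register `13` names an element; the value `B` means that nothing is affordable.
-/
theorem wp_cheapestCmd (h : Ctx E n N K B s) (hM : N ≤ M) :
    WP (M * 16 + 7) cheapestCmd s fun s' => s'.reg 12 ≤ B ∧
      (∀ j ∈ E (s.reg 6), s'.reg 12 ≤ s.mem 4 j 0) ∧
      (s'.reg 12 < B → s'.reg 13 ∈ E (s.reg 6) ∧ s.mem 4 (s'.reg 13) 0 = s'.reg 12) := by
  refine WP.seq (a := 1) (b := M * 16 + 5) (WP.add le_rfl ?_) (by omega)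
  refine (WP.forTo (L := N) (M := M) (t := 11)
    (fun k s' => s'.reg 12 ≤ B ∧ (∀ j ∈ E (s.reg 6), j < k → s'.reg 12 ≤ s.mem 4 j 0) ∧
      (s'.reg 12 < B → s'.reg 13 ∈ E (s.reg 6) ∧ s.mem 4 (s'.reg 13) 0 = s'.reg 12))
    ?_ ?_ hM (by decide) (by decide) ?_ ?_ ?_ le_rfl).mono le_rfl ?_
  · simpa [setReg_reg] using h.hN
  · simpa [setReg_reg] using h.one
  · intro k s v w hI
    simpa [setReg_reg] using hI
  · simp [setReg_reg, h.hB, h.zero]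
  · intro k s' hk hr hm hi hI
    have h6 : s'.reg 6 = s.reg 6 := hr 6 (by decide) (by decide) (by decide)
    have h3 : s'.reg 3 = 0 := (hr 3 (by decide) (by decide) (by decide)).trans h.zero
    have h0 : s'.mem 0 = s.mem 0 := hm 0 (by decide)
    have h4 : s'.mem 4 = s.mem 4 := hm 4 (by decide)
    refine WP.seq (a := 1) (b := 9) (WP.load le_rfl ?_) le_rfl
    refine WP.ite (a := 8) (fun hx => ?_) (fun hx => WP.skip (by omega) ?_) le_rfl
    · replace hx : k ∈ E (s.reg 6) := by
        by_contra hk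
        simp [setReg_reg, h6, hi, h0, h.inc, hk] at hx
      refine WP.seq (a := 1) (b := 6) (WP.load le_rfl ?_) le_rfl
      refine WP.seq (a := 1) (b := 4) (WP.sub le_rfl ?_) le_rfl
      refine WP.ite (a := 3) (fun hy => ?_) (fun hy => WP.skip (by omega) ?_) le_rfl
      · refine WP.seq (a := 1) (b := 1) (WP.add le_rfl (WP.add le_rfl ?_)) le_rfl
        simp [setReg_reg, setReg_mem, h3, hi, h4] at hy ⊢
        refine ⟨by omega, fun j hj hjk => ?_, fun _ => hx⟩
        rcases hjk.lt_or_eq with hlt | rfl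
        · have := hI.2.1 j hj hlt
          omega
        · exact le_rfl
      · simp [setReg_reg, setReg_mem, h3, hi, h4] at hy ⊢
        refine ⟨hI.1, fun j hj hjk => ?_, hI.2.2⟩
        rcases hjk.lt_or_eq with hlt | rfl
        · exact hI.2.1 j hj hlt
        · omega
    · replace hx : k ∉ E (s.reg 6) := by
        intro hk
        simp [setReg_reg, h6, hi, h0, h.inc, hk] at hx
      simp only [setReg_reg]
      refine ⟨hI.1, fun j hj hjk => hI.2.1 j hj ?_, hI.2.2⟩
      have : j ≠ k := by rintro rfl; exact hx hj
      omega
  · rintro s' ⟨h1, h2, h3⟩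
    exact ⟨h1, fun j hj => h2 j hj (mem_range.1 (h.sub _ hj)), h3⟩

/-- The effect on the memory of set number `i` buying the element `j`. -/
structure Bought (i j : ℕ) (m m' : ℕ → ℕ → ℕ → ℕ) : Prop where
  sel : ∀ k, m' 1 k 0 =
    if k = i then 1 else if m 4 j 0 ≠ 0 ∧ k = m 3 j 0 then 0 else m 1 k 0
  part : ∀ k l, m' 2 k l =
    if k = i ∧ l = j then 1 else if m 4 j 0 ≠ 0 ∧ k = m 3 j 0 ∧ l = j then 0 else m 2 k l
  own : ∀ l, m' 3 l 0 = if l = j then i else m 3 l 0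
  price : ∀ l, m' 4 l 0 = if l = j then m 4 j 0 + 1 else m 4 l 0

/-- Eviction is guarded by the price, since the initial owner `0` is also a genuine index. The
eviction precedes the purchase, so the buyer's entries prevail. -/
theorem wp_buyCmd (h : Ctx E n N K B s) (hp : s.mem 4 (s.reg 13) 0 = s.reg 12) :
    WP 16 buyCmd s fun s' => Bought (s.reg 6) (s.reg 13) s.mem s'.mem := by
  have h2 := h.one
  have h3 := h.zero
  refine WP.seq (a := 6) (b := 9) ?_ le_rfl
  refine WP.ite (a := 5) (fun hx => ?_) (fun hx => WP.skip (by omega) ?_) le_rfl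
  · refine WP.seq (a := 1) (b := 3) (WP.load le_rfl ?_) le_rfl
    refine WP.seq (a := 1) (b := 1) (WP.store le_rfl (WP.store le_rfl ?_)) le_rfl
    refine WP.seq (a := 1) (b := 7) (WP.add le_rfl ?_) le_rfl
    refine WP.seq (a := 1) (b := 5) (WP.store le_rfl ?_) le_rfl
    refine WP.seq (a := 1) (b := 3) (WP.store le_rfl ?_) le_rfl
    refine WP.seq (a := 1) (b := 1) (WP.store le_rfl (WP.store le_rfl ?_)) le_rfl
    constructor <;> intros <;>
      simp [setReg_reg, setReg_mem, setMem_reg, setMem_mem, h2, h3, hp, hx]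
  · refine WP.seq (a := 1) (b := 7) (WP.add le_rfl ?_) le_rfl
    refine WP.seq (a := 1) (b := 5) (WP.store le_rfl ?_) le_rfl
    refine WP.seq (a := 1) (b := 3) (WP.store le_rfl ?_) le_rfl
    refine WP.seq (a := 1) (b := 1) (WP.store le_rfl (WP.store le_rfl ?_)) le_rfl
    constructor <;> intros <;>
      simp [setReg_reg, setReg_mem, setMem_reg, setMem_mem, h2, h3, hp, hx]

/-- Set number `i` does not want to buy: it is large, or has been selected, or cannot afford any
of its elements. -/
def Content (E : ℕ → Finset ℕ) (K B : ℕ) (m : ℕ → ℕ → ℕ → ℕ) (i : ℕ) : Prop :=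
  (E i).card ≤ K → m 1 i 0 = 0 → ∀ j ∈ E i, B ≤ m 4 j 0

theorem wp_auctionStep (h : Ctx E n N K B s) (hM : N ≤ M) :
    WP (M * 24 + 100) auctionStep s fun s' =>
      (s'.mem = s.mem ∧ Content E K B s.mem (s.reg 6)) ∨
      ((E (s.reg 6)).card ≤ K ∧ s.mem 1 (s.reg 6) 0 = 0 ∧ ∃ j ∈ E (s.reg 6), s.mem 4 j 0 < B ∧
        (∀ j' ∈ E (s.reg 6), s.mem 4 j 0 ≤ s.mem 4 j' 0) ∧
        Bought (s.reg 6) j s.mem s'.mem) := by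
  refine WP.seq (a := M * 8 + 7) (b := M * 16 + 92) ?_ (by omega)
  refine (wp_sizeCmd h hM).frame.mono le_rfl ?_
  rintro s₁ ⟨h10, hf⟩
  have hm₁ : s₁.mem = s.mem := funext fun a => hf.mem a (by simp [sizeCmd, forTo, Cmd.stores])
  have h6₁ : s₁.reg 6 = s.reg 6 := hf.reg 6 (by decide)
  have hc₁ : Ctx E n N K B s₁ := h.of_eq
    (fun x hx => hf.reg x (by interval_cases x <;> decide)) (by rw [hm₁])
  refine WP.seq (a := 1) (b := M * 16 + 90) (WP.sub le_rfl ?_) (by omega)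
  refine WP.ite (a := M * 16 + 80) (fun hx => WP.skip (by omega) (.inl ⟨hm₁, ?_⟩)) (fun hx => ?_)
    (by omega)
  · simp only [setReg_reg, if_true, h10, hc₁.hK] at hx
    intro hle
    omega
  have hsmall : (E (s.reg 6)).card ≤ K := by
    simp only [setReg_reg, if_true, h10, hc₁.hK] at hx
    omega
  clear hx
  refine WP.seq (a := 1) (b := M * 16 + 70) (WP.load le_rfl ?_) (by omega)
  refine WP.ite (a := M * 16 + 60) (fun hx => WP.skip (by omega) (.inl ⟨hm₁, ?_⟩)) (fun hx => ?_)
    (by omega)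
  · intro _ hsel
    simp [setReg_reg, setReg_mem, hm₁, h6₁, hc₁.zero, hsel] at hx
  have hsel : s.mem 1 (s.reg 6) 0 = 0 := by
    simpa [setReg_reg, setReg_mem, hm₁, h6₁, hc₁.zero] using hx
  clear hx
  generalize hs₂ : State.setReg _ _ _ = s₂
  have hm₂ : s₂.mem = s.mem := by rw [← hs₂]; exact hm₁
  have h6₂ : s₂.reg 6 = s.reg 6 := by rw [← hs₂]; simpa [setReg_reg] using h6₁
  have hc₂ : Ctx E n N K B s₂ := hc₁.of_eq
    (fun x hx => by rw [← hs₂]; interval_cases x <;> simp [setReg_reg]) (by rw [hm₁, hm₂])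
  refine WP.seq (a := M * 16 + 7) (b := 50) ?_ (by omega)
  refine (wp_cheapestCmd hc₂ hM).frame.mono le_rfl ?_
  rintro s₃ ⟨⟨hle, hmin, hlt⟩, hf₃⟩
  rw [h6₂, hm₂] at hmin hlt
  have hm₃ : s₃.mem = s.mem :=
    (funext fun a => hf₃.mem a (by simp [cheapestCmd, forTo, Cmd.stores])).trans hm₂
  have h6₃ : s₃.reg 6 = s.reg 6 := (hf₃.reg 6 (by decide)).trans h6₂
  have hc₃ : Ctx E n N K B s₃ := hc₂.of_eq
    (fun x hx => hf₃.reg x (by interval_cases x <;> decide)) (by rw [hm₃, hm₂])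
  refine WP.seq (a := 1) (b := 40) (WP.sub le_rfl ?_) (by omega)
  refine WP.ite (a := 16) (fun hx => ?_) (fun hx => WP.skip (by omega) (.inl ⟨hm₃, ?_⟩)) (by omega)
  · have hB : s₃.reg 12 < B := by
      simp only [setReg_reg, if_true, hc₃.hB] at hx
      omega
    obtain ⟨hj, hprice⟩ := hlt hB
    generalize hs₄ : State.setReg _ _ _ = s₄
    have hm₄ : s₄.mem = s.mem := by rw [← hs₄]; exact hm₃
    have h6₄ : s₄.reg 6 = s.reg 6 := by rw [← hs₄]; simpa [setReg_reg] using h6₃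
    have h12 : s₄.reg 12 = s₃.reg 12 := by rw [← hs₄]; simp [setReg_reg]
    have h13 : s₄.reg 13 = s₃.reg 13 := by rw [← hs₄]; simp [setReg_reg]
    have hc₄ : Ctx E n N K B s₄ := hc₃.of_eq
      (fun x hx => by rw [← hs₄]; interval_cases x <;> simp [setReg_reg]) (by rw [hm₄, hm₃])
    refine (wp_buyCmd hc₄ (by rw [hm₄, h12, h13, hprice])).mono le_rfl fun s' hs' => ?_
    rw [h6₄, h13, hm₄] at hs'
    exact .inr ⟨hsmall, hsel, _, hj, hprice ▸ hB, fun j' hj' => hprice ▸ hmin j' hj', hs'⟩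
  · simp only [setReg_reg, if_true, hc₃.hB] at hx
    intro _ _ j hj
    have := hmin j hj
    omega

/-- With truncated subtraction the result is zero exactly when the free elements make up at least a
`1 / K` fraction of the set, a test that avoids division. -/
theorem wp_countFreeCmd (h : Ctx E n N K B s) (hM : N ≤ M)
    (h10 : s.reg 10 = (E (s.reg 6)).card) :
    WP (M * 15 + 7) countFreeCmd s fun s' => s'.reg 19 =
      (E (s.reg 6)).card - K * ((E (s.reg 6)).filter fun j => s.mem 4 j 0 = 0).card := by
  set F := (E (s.reg 6)).filter fun j => s.mem 4 j 0 = 0 with hF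
  refine WP.seq (a := 1) (b := M * 15 + 5) (WP.add le_rfl ?_) (by omega)
  refine (WP.forTo (L := N) (M := M) (t := 10)
    (fun k s' => s'.reg 19 = (E (s.reg 6)).card - K * (F.filter (· < k)).card)
    ?_ ?_ hM (by decide) (by decide) ?_ ?_ ?_ le_rfl).mono le_rfl ?_
  · simpa [setReg_reg] using h.hN
  · simpa [setReg_reg] using h.one
  · intro k s v w hI
    simpa [setReg_reg] using hI
  · simp [setReg_reg, h10, h.zero]
  · intro k s' hk hr hm hi hI
    have h6 : s'.reg 6 = s.reg 6 := hr 6 (by decide) (by decide) (by decide)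
    have h3 : s'.reg 3 = 0 := (hr 3 (by decide) (by decide) (by decide)).trans h.zero
    have hK : s'.reg 4 = K := (hr 4 (by decide) (by decide) (by decide)).trans h.hK
    have h0 : s'.mem 0 = s.mem 0 := hm 0 (by decide)
    have h4 : s'.mem 4 = s.mem 4 := hm 4 (by decide)
    refine WP.seq (a := 1) (b := 8) (WP.load le_rfl ?_) le_rfl
    refine WP.ite (a := 7) (fun hx => ?_) (fun hx => WP.skip (by omega) ?_) le_rfl
    · replace hx : k ∈ E (s.reg 6) := by
        by_contra hk
        simp [setReg_reg, h6, hi, h0, h.inc, hk] at hx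
      refine WP.seq (a := 1) (b := 5) (WP.load le_rfl ?_) le_rfl
      refine WP.ite (a := 3) (fun hy => WP.skip (by omega) ?_) (fun hy => WP.sub (by omega) ?_)
        (by omega)
      · have hkF : k ∉ F := by
          simpa [setReg_reg, setReg_mem, h3, hi, h4, hF, hx] using hy
        rw [filter_lt_succ_of_notMem hkF]
        simpa [setReg_reg] using hI
      · have hkF : k ∈ F := by
          simpa [setReg_reg, setReg_mem, h3, hi, h4, hF, hx] using hy
        rw [filter_lt_succ_of_mem hkF, card_insert_of_notMem (by simp)]
        simp only [setReg_reg, hI, hK, Nat.mul_add]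
        simp
        omega
    · have hkF : k ∉ F := by
        intro hk
        simp [setReg_reg, h6, hi, h0, h.inc, (mem_filter.1 hk).1] at hx
      rw [filter_lt_succ_of_notMem hkF]
      simpa [setReg_reg] using hI
  · intro s' hI
    rw [hI, filter_lt_of_subset ((filter_subset _ _).trans (h.sub _))]

/-- The effect on prices and parts of set number `i` taking the elements of `G`. -/
structure Grabbed (i : ℕ) (G : Finset ℕ) (m m' : ℕ → ℕ → ℕ → ℕ) : Prop where
  part : ∀ k l, m' 2 k l = if k = i ∧ l ∈ G then 1 else m 2 k l
  price : ∀ l, m' 4 l 0 = if l ∈ G then 1 else m 4 l 0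

/-- Register `19` is the size minus `K` per element taken. As long as it is positive, every free
element seen so far has been taken; hence it reaches zero if there are enough. An element is taken
only while it is positive, so the overshoot is less than `K`. -/
theorem wp_grabCmd (h : Ctx E n N K B s) (hM : N ≤ M)
    (h10 : s.reg 10 = (E (s.reg 6)).card) (hKpos : 0 < K)
    (henough : (E (s.reg 6)).card ≤
      K * ((E (s.reg 6)).filter fun j => s.mem 4 j 0 = 0).card) :
    WP (M * 20 + 7) grabCmd s fun s' => ∃ G ⊆ (E (s.reg 6)).filter fun j => s.mem 4 j 0 = 0,
      (E (s.reg 6)).card ≤ K * G.card ∧ K * G.card < (E (s.reg 6)).card + K ∧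
      Grabbed (s.reg 6) G s.mem s'.mem := by
  set F := (E (s.reg 6)).filter fun j => s.mem 4 j 0 = 0 with hF
  refine WP.seq (a := 1) (b := M * 20 + 5) (WP.add le_rfl ?_) (by omega)
  refine (WP.forTo (L := N) (M := M) (t := 15)
    (fun k s' => ∃ G ⊆ F.filter (· < k), s'.reg 19 = (E (s.reg 6)).card - K * G.card ∧
      K * G.card < (E (s.reg 6)).card + K ∧ (s'.reg 19 ≠ 0 → G = F.filter (· < k)) ∧
      Grabbed (s.reg 6) G s.mem s'.mem)
    ?_ ?_ hM (by decide) (by decide) ?_ ?_ ?_ le_rfl).mono le_rfl ?_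
  · simpa [setReg_reg] using h.hN
  · simpa [setReg_reg] using h.one
  · intro k s v w hI
    simpa [setReg_reg, setReg_mem] using hI
  · refine ⟨∅, by simp, by simp [setReg_reg, h10, h.zero], by simp; omega, by simp, ?_⟩
    constructor <;> simp [setReg_mem]
  · rintro k s' hk hr hm hi ⟨G, hGF, h19, hGlt, hG, hgr⟩
    have h6 : s'.reg 6 = s.reg 6 := hr 6 (by decide) (by decide) (by decide)
    have h2 : s'.reg 2 = 1 := (hr 2 (by decide) (by decide) (by decide)).trans h.one
    have h3 : s'.reg 3 = 0 := (hr 3 (by decide) (by decide) (by decide)).trans h.zero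
    have hK : s'.reg 4 = K := (hr 4 (by decide) (by decide) (by decide)).trans h.hK
    have h0 : s'.mem 0 = s.mem 0 := hm 0 (by decide)
    have hkG : k ∉ G := fun hk => absurd (mem_filter.1 (hGF hk)).2 (lt_irrefl _)
    have h4 : s'.mem 4 k 0 = s.mem 4 k 0 := by rw [hgr.price, if_neg hkG]
    have hmono : F.filter (· < k) ⊆ F.filter (· < k + 1) := fun x hx => by
      simp only [mem_filter] at hx ⊢
      exact ⟨hx.1, by omega⟩
    have hsame : k ∉ F → ∀ s'' : State, s''.reg 19 = s'.reg 19 → s''.mem = s'.mem →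
        ∃ G ⊆ F.filter (· < k + 1), s''.reg 19 = (E (s.reg 6)).card - K * G.card ∧
        K * G.card < (E (s.reg 6)).card + K ∧ (s''.reg 19 ≠ 0 → G = F.filter (· < k + 1)) ∧
        Grabbed (s.reg 6) G s.mem s''.mem := by
      intro hkF s'' e19 em
      rw [e19, em, filter_lt_succ_of_notMem hkF]
      exact ⟨G, hGF, h19, hGlt, hG, hgr⟩
    refine WP.seq (a := 1) (b := 13) (WP.load le_rfl ?_) le_rfl
    refine WP.ite (a := 12) (fun hx => ?_) (fun hx => WP.skip (by omega) ?_) le_rfl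
    · replace hx : k ∈ E (s.reg 6) := by
        by_contra hk
        simp [setReg_reg, h6, hi, h0, h.inc, hk] at hx
      refine WP.seq (a := 1) (b := 10) (WP.load le_rfl ?_) le_rfl
      refine WP.ite (a := 8) (fun hy => WP.skip (by omega) ?_) (fun hy => ?_) (by omega)
      · refine hsame ?_ _ (by simp [setReg_reg]) rfl
        simpa [setReg_reg, setReg_mem, h3, hi, h4, hF, hx] using hy
      · have hkF : k ∈ F := by
          simpa [setReg_reg, setReg_mem, h3, hi, h4, hF, hx] using hy
        refine WP.ite (a := 7) (fun hz => ?_) (fun hz => WP.skip (by omega) ?_) (by omega)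
        · replace hz : s'.reg 19 ≠ 0 := by simpa [setReg_reg] using hz
          refine WP.seq (a := 1) (b := 3) (WP.sub le_rfl ?_) (by omega)
          refine WP.seq (a := 1) (b := 1) (WP.store le_rfl (WP.store le_rfl ?_)) le_rfl
          have hcard : (insert k G).card = G.card + 1 := card_insert_of_notMem hkG
          refine ⟨insert k G, ?_, ?_, ?_, fun _ => ?_, ?_⟩
          · rw [filter_lt_succ_of_mem hkF]
            exact insert_subset_insert _ hGF
          · rw [hcard, Nat.mul_add]
            simp [setReg_reg, setMem_reg, h19, hK]
            omega
          · rw [hcard, Nat.mul_add]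
            omega
          · rw [filter_lt_succ_of_mem hkF, hG hz]
          · constructor <;> intros <;>
              simp [setReg_reg, setReg_mem, setMem_reg, setMem_mem, hi, h6, h2, h3, hgr.part,
                hgr.price] <;> grind
        · replace hz : s'.reg 19 = 0 := by simpa [setReg_reg] using hz
          refine ⟨G, hGF.trans hmono, by simpa [setReg_reg] using h19, hGlt, fun h => ?_, hgr⟩
          simp [setReg_reg, hz] at h
    · refine hsame (fun hk => ?_) _ (by simp [setReg_reg]) rfl
      simp [setReg_reg, h6, hi, h0, h.inc, (mem_filter.1 hk).1] at hx
  · rintro s' ⟨G, hGF, h19, hGlt, hG, hgr⟩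
    rw [filter_lt_of_subset ((filter_subset _ _).trans (h.sub _))] at hGF hG
    refine ⟨G, hGF, ?_, hGlt, hgr⟩
    by_cases hz : s'.reg 19 = 0
    · omega
    · rw [hG hz]
      exact henough

theorem wp_greedyStep (h : Ctx E n N K B s) (hM : N ≤ M) (hKpos : 0 < K) :
    WP (M * 43 + 100) greedyStep s fun s' =>
      (s'.mem = s.mem ∧ (E (s.reg 6)).card ≠ s.reg 16 + K + 1) ∨
      ((E (s.reg 6)).card = s.reg 16 + K + 1 ∧
        ((s'.mem = s.mem ∧ K * ((E (s.reg 6)).filter fun j => s.mem 4 j 0 = 0).card <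
            (E (s.reg 6)).card) ∨
          ∃ G ⊆ (E (s.reg 6)).filter fun j => s.mem 4 j 0 = 0,
            (E (s.reg 6)).card ≤ K * G.card ∧ K * G.card < (E (s.reg 6)).card + K ∧
            Grabbed (s.reg 6) G s.mem s'.mem ∧
            ∀ k, s'.mem 1 k 0 = if k = s.reg 6 then 1 else s.mem 1 k 0)) := by
  refine WP.seq (a := M * 8 + 7) (b := M * 35 + 92) ?_ (by omega)
  refine (wp_sizeCmd h hM).frame.mono le_rfl ?_
  rintro s₁ ⟨h10, hf⟩
  have hm₁ : s₁.mem = s.mem := funext fun a => hf.mem a (by simp [sizeCmd, forTo, Cmd.stores])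
  have h6₁ : s₁.reg 6 = s.reg 6 := hf.reg 6 (by decide)
  have h16₁ : s₁.reg 16 = s.reg 16 := hf.reg 16 (by decide)
  have hc₁ : Ctx E n N K B s₁ := h.of_eq
    (fun x hx => hf.reg x (by interval_cases x <;> decide)) (by rw [hm₁])
  refine WP.seq (a := 1) (b := M * 35 + 90) (WP.add le_rfl ?_) (by omega)
  refine WP.seq (a := 1) (b := M * 35 + 80) (WP.add le_rfl ?_) (by omega)
  refine WP.seq (a := 1) (b := M * 35 + 70) (WP.sub le_rfl ?_) (by omega)
  refine WP.seq (a := 1) (b := M * 35 + 60) (WP.sub le_rfl ?_) (by omega)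
  refine WP.seq (a := 1) (b := M * 35 + 50) (WP.add le_rfl ?_) (by omega)
  generalize hs₂ : State.setReg _ _ _ = s₂
  have hm₂ : s₂.mem = s.mem := by rw [← hs₂]; exact hm₁
  have h6₂ : s₂.reg 6 = s.reg 6 := by rw [← hs₂]; simpa [setReg_reg] using h6₁
  have h10₂ : s₂.reg 10 = (E (s.reg 6)).card := by rw [← hs₂]; simpa [setReg_reg] using h10
  -- The sum of the two truncated differences vanishes exactly when the numbers are equal.
  have h11 : s₂.reg 11 = 0 ↔ (E (s.reg 6)).card = s.reg 16 + K + 1 := by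
    rw [← hs₂]
    simp [setReg_reg, h10, h16₁, hc₁.hK, hc₁.one]
    omega
  have hc₂ : Ctx E n N K B s₂ := hc₁.of_eq
    (fun x hx => by rw [← hs₂]; interval_cases x <;> simp [setReg_reg]) (by rw [hm₁, hm₂])
  clear hs₂
  refine WP.ite (a := M * 35 + 40) (fun hx => WP.skip (by omega) (.inl ⟨hm₂, mt h11.2 hx⟩))
    (fun hx => ?_) (by omega)
  have hsize := h11.1 hx
  refine WP.seq (a := M * 15 + 7) (b := M * 20 + 30) ?_ (by omega)
  refine (wp_countFreeCmd hc₂ hM (by rw [h10₂, h6₂])).frame.mono le_rfl ?_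
  rintro s₃ ⟨h19, hf₃⟩
  rw [h6₂, hm₂] at h19
  have hm₃ : s₃.mem = s.mem :=
    (funext fun a => hf₃.mem a (by simp [countFreeCmd, forTo, Cmd.stores])).trans hm₂
  have h6₃ : s₃.reg 6 = s.reg 6 := (hf₃.reg 6 (by decide)).trans h6₂
  have h10₃ : s₃.reg 10 = (E (s.reg 6)).card := (hf₃.reg 10 (by decide)).trans h10₂
  have hc₃ : Ctx E n N K B s₃ := hc₂.of_eq
    (fun x hx => hf₃.reg x (by interval_cases x <;> decide)) (by rw [hm₃, hm₂])
  refine WP.ite (a := M * 20 + 20) (fun hy => WP.skip (by omega) (.inr ⟨hsize, .inl ⟨hm₃, ?_⟩⟩))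
    (fun hy => ?_) (by omega)
  · omega
  refine WP.seq (a := M * 20 + 7) (b := 1) ?_ (by omega)
  refine (wp_grabCmd hc₃ hM (by rw [h10₃, h6₃]) hKpos
    (by rw [h6₃, hm₃]; omega)).frame.mono le_rfl ?_
  rintro s₄ ⟨⟨G, hGF, hGle, hGlt, hgr⟩, hf₄⟩
  rw [h6₃, hm₃] at hGF hgr
  rw [h6₃] at hGle hGlt
  have h1₄ : s₄.mem 1 = s.mem 1 := (hf₄.mem 1 (by decide)).trans (by rw [hm₃])
  have h6₄ : s₄.reg 6 = s.reg 6 := (hf₄.reg 6 (by decide)).trans h6₃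
  have h2₄ : s₄.reg 2 = 1 := (hf₄.reg 2 (by decide)).trans hc₃.one
  have h3₄ : s₄.reg 3 = 0 := (hf₄.reg 3 (by decide)).trans hc₃.zero
  refine WP.store le_rfl (.inr ⟨hsize, .inr ⟨G, hGF, hGle, hGlt, ?_, fun k => ?_⟩⟩)
  · constructor <;> intros <;> simp [setMem_mem, hgr.part, hgr.price]
  · simp [setMem_mem, h1₄, h6₄, h2₄, h3₄]

end SetPacking

namespace SetPacking

open Finset RAM

variable {E : ℕ → Finset ℕ} {n N K B M : ℕ} {s : State}

/-! ### The auction -/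

/-- The invariant of the auction: every selected set is small and holds exactly one element, which
is a cheapest one up to one unit, and the elements held are those with a positive price. -/
structure AuctionInv (E : ℕ → Finset ℕ) (K B : ℕ) (m : ℕ → ℕ → ℕ → ℕ) : Prop where
  part_iff : ∀ i j, m 2 i j ≠ 0 ↔ m 4 j 0 ≠ 0 ∧ m 3 j 0 = i
  sel_iff : ∀ i, m 1 i 0 ≠ 0 ↔ ∃ j, m 2 i j ≠ 0
  unique : ∀ i j j', m 2 i j ≠ 0 → m 2 i j' ≠ 0 → j = j'
  mem : ∀ i j, m 2 i j ≠ 0 → j ∈ E i ∧ (E i).card ≤ K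
  min : ∀ i j, m 2 i j ≠ 0 → ∀ j' ∈ E i, m 4 j 0 ≤ m 4 j' 0 + 1
  le : ∀ j, m 4 j 0 ≤ B

/-- Prices only rise, so near-minimality persists for the other holders; the buyer pays one unit
more than a minimum, and the previous owner loses its only element. -/
theorem AuctionInv.bought {m m' : ℕ → ℕ → ℕ → ℕ} (h : AuctionInv E K B m) {i j : ℕ}
    (hsmall : (E i).card ≤ K) (hsel : m 1 i 0 = 0) (hj : j ∈ E i) (hlt : m 4 j 0 < B)
    (hmin : ∀ j' ∈ E i, m 4 j 0 ≤ m 4 j' 0) (hb : Bought i j m m') : AuctionInv E K B m' := by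
  have hi : ∀ l, m 2 i l = 0 := fun l => by
    by_contra hl
    exact (h.sel_iff i).2 ⟨l, hl⟩ hsel
  -- By `part_iff` only the recorded owner can have a nonzero entry in column `j`, so after the
  -- eviction the buyer's entry is the only one.
  have hpart : ∀ k l, m' 2 k l = if l = j then (if k = i then 1 else 0) else m 2 k l := by
    intro k l
    have := h.part_iff k l
    rw [hb.part]
    grind
  refine ⟨fun k l => ?_, fun k => ?_, fun k l l' => ?_, fun k l => ?_, fun k l hkl l' hl' => ?_,
    fun l => ?_⟩
  · rw [hpart, hb.price, hb.own]
    have := h.part_iff k l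
    grind
  · rw [hb.sel]
    by_cases hk : k = i
    · simp only [hk, if_true, ne_eq, one_ne_zero, not_false_eq_true, true_iff]
      exact ⟨j, by rw [hpart]; simp⟩
    · simp only [hk, if_false]
      split_ifs with hown
      · simp only [ne_eq, not_true_eq_false, false_iff, not_exists, not_not]
        intro l
        rw [hpart]
        have := (h.part_iff k j).2 ⟨hown.1, hown.2.symm⟩
        have := h.unique k j l this
        grind
      · rw [h.sel_iff]
        have hkj := h.part_iff k j
        refine exists_congr fun l => ?_
        rw [hpart]
        grind
  · rw [hpart, hpart]
    have := h.unique k l l'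
    grind
  · rw [hpart]
    have := h.mem k l
    grind
  · rw [hpart] at hkl
    rw [hb.price, hb.price]
    have h1 := h.min k l
    have h2 := hmin l'
    grind
  · rw [hb.price]
    have := h.le l
    split_ifs <;> omega

theorem Bought.sum_price {m m' : ℕ → ℕ → ℕ → ℕ} {i j : ℕ} (hb : Bought i j m m') (hj : j < N) :
    ∑ l ∈ range N, m' 4 l 0 = ∑ l ∈ range N, m 4 l 0 + 1 := by
  have hj' : j ∈ range N := mem_range.2 hj
  rw [← Finset.add_sum_erase _ _ hj', ← Finset.add_sum_erase (range N) (fun l => m 4 l 0) hj',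
    hb.price, if_pos rfl, Finset.sum_congr rfl (g := fun l => m 4 l 0)]
  · ring
  · intro l hl
    rw [hb.price, if_neg (Finset.ne_of_mem_erase hl)]

/-- The price sum is the potential: a full round either leaves every set content or increases the
sum. Once all sets are content, nothing is bought any more. -/
theorem wp_auctionCmd (h : Ctx E n N K B s) (hM : N ≤ M) (hM' : n ≤ M)
    (h0 : ∀ a i j, a ≠ 0 → s.mem a i j = 0) :
    WP (B * 6 + 13 + (1 + B * M) * (M * (M * 24 + 105) + 10)) auctionCmd s fun s' =>
      AuctionInv E K B s'.mem ∧ ∀ i < n, Content E K B s'.mem i := by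
  refine WP.seq (a := B * 6 + 7) (b := (1 + B * M) * (M * (M * 24 + 105) + 10) + 5) ?_ (by omega)
  -- The number of rounds, `1 + N * B`, is computed by repeated addition.
  refine WP.mono (t := B * 6 + 7) (Q := fun s' => s'.reg 15 = 1 + N * B ∧ Ctx E n N K B s' ∧
    s'.mem = s.mem) ?_ le_rfl ?_
  · refine WP.seq (a := 1) (b := B * 6 + 5) (WP.const le_rfl ?_) (by omega)
    refine (WP.forTo (L := B) (M := B) (t := 1) (fun k s' => s'.reg 15 = 1 + N * k)
      ?_ ?_ le_rfl (by decide) (by decide) ?_ ?_ ?_ le_rfl).frame.mono le_rfl ?_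
    · simpa [setReg_reg] using h.hB
    · simpa [setReg_reg] using h.one
    · intro k s v w hI
      simpa [setReg_reg] using hI
    · simp [setReg_reg]
    · intro k s' _ hr _ _ hI
      have h1 : s'.reg 1 = N := (hr 1 (by decide) (by decide) (by decide)).trans h.hN
      refine WP.add le_rfl ?_
      simp [setReg_reg, hI, h1]
      ring
    · rintro s' ⟨hI, hf⟩
      have hm : s'.mem = s.mem := funext fun a => hf.mem a (by simp [forTo, Cmd.stores])
      refine ⟨hI, h.of_eq (fun x hx => ?_) (by rw [hm]), hm⟩
      rw [hf.reg x (by interval_cases x <;> decide), setReg_reg, if_neg (by omega)]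
  rintro s₁ ⟨h15, hc, hm₁⟩
  have hL : 1 + N * B ≤ 1 + B * M := by rw [mul_comm]; gcongr
  refine (WP.forTo (L := 1 + N * B) (M := 1 + B * M) (t := M * (M * 24 + 105) + 5)
    (fun k s' => AuctionInv E K B s'.mem ∧ ((∀ i < n, Content E K B s'.mem i) ∨
      k ≤ ∑ l ∈ range N, s'.mem 4 l 0))
    h15 hc.one hL (by decide) (by decide) ?_ ?_ ?_ le_rfl).mono le_rfl ?_
  · intro k s v w hI
    exact hI
  · refine ⟨?_, .inr (Nat.zero_le _)⟩
    rw [hm₁]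
    constructor <;> simp [h0]
  · rintro k s₂ _ hr hm _ ⟨hI, hprog⟩
    have hc₂ : Ctx E n N K B s₂ := hc.of_eq
      (fun x hx => hr x (by interval_cases x <;> decide) (by omega) (by omega)) (hm 0 (by decide))
    refine (WP.forTo (L := n) (M := M) (t := M * 24 + 100)
      (fun i s' => AuctionInv E K B s'.mem ∧ ((∀ i < n, Content E K B s'.mem i) ∨
        k + 1 ≤ ∑ l ∈ range N, s'.mem 4 l 0 ∨
        (k ≤ ∑ l ∈ range N, s'.mem 4 l 0 ∧ ∀ i' < i, Content E K B s'.mem i')))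
      hc₂.hn hc₂.one hM' (by decide) (by decide) ?_ ?_ ?_ le_rfl).mono le_rfl ?_
    · intro k s v w hI
      exact hI
    · exact ⟨hI, hprog.imp id fun h => .inr ⟨h, fun _ h => absurd h (Nat.not_lt_zero _)⟩⟩
    · rintro i s₃ hin hr₃ hm₃ hi ⟨hI₃, hprog₃⟩
      have hc₃ : Ctx E n N K B s₃ := hc₂.of_eq
        (fun x hx => hr₃ x (by interval_cases x <;> decide) (by omega) (by omega))
        (hm₃ 0 (by decide))
      refine (wp_auctionStep hc₃ hM).mono le_rfl ?_
      rw [hi]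
      rintro s₄ (⟨hmem, hcont⟩ | ⟨hsmall, hsel, j, hj, hlt, hmin, hb⟩)
      · rw [hmem]
        refine ⟨hI₃, hprog₃.imp id (Or.imp id fun h => ⟨h.1, fun i' hi' => ?_⟩)⟩
        rcases Nat.lt_succ_iff_lt_or_eq.1 hi' with h' | rfl
        · exact h.2 i' h'
        · exact hcont
      · refine ⟨hI₃.bought hsmall hsel hj hlt hmin hb, ?_⟩
        have hsum := hb.sum_price (mem_range.1 (hc.sub _ hj))
        rcases hprog₃ with h' | h' | h'
        · have := h' i hin hsmall hsel j hj
          omega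
        · exact .inr (.inl (by omega))
        · exact .inr (.inl (by omega))
    · rintro s' ⟨hI', h'⟩
      refine ⟨hI', ?_⟩
      rcases h' with h' | h' | h'
      · exact .inl h'
      · exact .inr h'
      · exact .inl h'.2
  · rintro s' ⟨hI, h'⟩
    refine ⟨hI, h'.resolve_right fun h' => ?_⟩
    -- If some set were not content, the sum would be at least `1 + N * B`, yet prices are at most
    -- `B`.
    have : ∑ l ∈ range N, s'.mem 4 l 0 ≤ N * B := by
      simpa using Finset.sum_le_card_nsmul (range N) (fun l => s'.mem 4 l 0) B fun l _ => hI.le l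
    omega

/-- The selected indices. -/
def chosen (n : ℕ) (m : ℕ → ℕ → ℕ → ℕ) : Finset ℕ := (range n).filter fun i => m 1 i 0 ≠ 0

theorem AuctionInv.bound {m : ℕ → ℕ → ℕ → ℕ} (h : AuctionInv E K B m)
    (hn : ∀ i, (E i).Nonempty → i < n) (hcont : ∀ i < n, Content E K B m i) {I : Finset ℕ}
    (hI : ∀ i ∈ I, (E i).card ≤ K) (hne : ∀ i ∈ I, (E i).Nonempty)
    (hdisj : (I : Set ℕ).PairwiseDisjoint E) : B * I.card ≤ (B + 1) * (chosen n m).card := by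
  have hex : ∀ t ∈ chosen n m, ∃ j, m 2 t j ≠ 0 := fun t ht =>
    (h.sel_iff t).1 (mem_filter.1 ht).2
  choose! g hg using hex
  refine auction_duality (price := fun j => m 4 j 0) (g := g) h.le ?_ ?_ ?_ ?_ hne hdisj
  · intro a ha b hb hab
    have h1 := ((h.part_iff _ _).1 (hg a ha)).2
    have h2 := ((h.part_iff _ _).1 (hg b hb)).2
    rw [← h1, ← h2, hab]
  · intro j hj
    have hp := (h.part_iff (m 3 j 0) j).2 ⟨hj, rfl⟩
    have hc : m 3 j 0 ∈ chosen n m :=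
      mem_filter.2 ⟨mem_range.2 (hn _ ⟨j, (h.mem _ _ hp).1⟩), (h.sel_iff _).2 ⟨j, hp⟩⟩
    exact ⟨_, hc, h.unique _ _ _ (hg _ hc) hp⟩
  · exact fun t ht => h.min t _ (hg t ht)
  · intro i hi hiT
    have hin := hn i (hne i hi)
    refine hcont i hin (hI i hi) ?_
    by_contra hsel
    exact hiT (mem_filter.2 ⟨mem_range.2 hin, hsel⟩)

/-! ### The greedy choice -/

/-- The elements held by set number `i`. -/
def held (E : ℕ → Finset ℕ) (m : ℕ → ℕ → ℕ → ℕ) (i : ℕ) : Finset ℕ :=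
  (E i).filter fun j => m 2 i j ≠ 0

/-- The invariant of the greedy choice; `T` is the family of small sets found by the auction. -/
structure GreedyInv (E : ℕ → Finset ℕ) (K : ℕ) (T : Finset ℕ) (m : ℕ → ℕ → ℕ → ℕ) : Prop where
  price_iff : ∀ j, m 4 j 0 ≠ 0 ↔ ∃ i, m 2 i j ≠ 0
  disj : ∀ i i' j, m 2 i j ≠ 0 → m 2 i' j ≠ 0 → i = i'
  mem : ∀ i j, m 2 i j ≠ 0 → j ∈ E i ∧ m 1 i 0 ≠ 0
  le : ∀ i, m 1 i 0 ≠ 0 → (E i).card ≤ K * (held E m i).card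
  lt : ∀ i, m 1 i 0 ≠ 0 → K * (held E m i).card < (E i).card + K
  small : ∀ i, (E i).card ≤ K → (m 1 i 0 ≠ 0 ↔ i ∈ T)

/-- A winner is small and nonempty and holds exactly one element, which satisfies both size bounds.
From here on prices serve only to mark occupied elements. -/
theorem AuctionInv.greedyInv {m : ℕ → ℕ → ℕ → ℕ} (h : AuctionInv E K B m)
    (hn : ∀ i, (E i).Nonempty → i < n) : GreedyInv E K (chosen n m) m := by
  have hone : ∀ i, m 1 i 0 ≠ 0 → (held E m i).card = 1 ∧ (E i).card ≤ K ∧ (E i).Nonempty := by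
    intro i hi
    obtain ⟨j, hj⟩ := (h.sel_iff i).1 hi
    refine ⟨card_eq_one.2 ⟨j, ?_⟩, (h.mem i j hj).2, j, (h.mem i j hj).1⟩
    ext l
    simp only [held, mem_filter, mem_singleton]
    exact ⟨fun hl => h.unique i l j hl.2 hj, fun hl => hl ▸ ⟨(h.mem i j hj).1, hj⟩⟩
  refine ⟨fun j => ⟨fun hj => ⟨_, (h.part_iff _ j).2 ⟨hj, rfl⟩⟩, fun ⟨i, hi⟩ =>
    ((h.part_iff i j).1 hi).1⟩, fun i i' j hi hi' => ?_, fun i j hij => ⟨(h.mem i j hij).1,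
    (h.sel_iff i).2 ⟨j, hij⟩⟩, fun i hi => ?_, fun i hi => ?_, fun i _ => ?_⟩
  · rw [← ((h.part_iff i j).1 hi).2, ← ((h.part_iff i' j).1 hi').2]
  · rw [(hone i hi).1, mul_one]
    exact (hone i hi).2.1
  · rw [(hone i hi).1, mul_one]
    have := (hone i hi).2.2.card_pos
    omega
  · simp only [chosen, mem_filter, mem_range]
    exact ⟨fun hi => ⟨hn i (hone i hi).2.2, hi⟩, fun hi => hi.2⟩

theorem GreedyInv.grabbed {T : Finset ℕ} {m m' : ℕ → ℕ → ℕ → ℕ} (h : GreedyInv E K T m) {i : ℕ}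
    {G : Finset ℕ} (hlarge : K < (E i).card) (hsel : m 1 i 0 = 0)
    (hG : G ⊆ (E i).filter fun j => m 4 j 0 = 0) (hle : (E i).card ≤ K * G.card)
    (hlt : K * G.card < (E i).card + K) (hgr : Grabbed i G m m')
    (hs : ∀ k, m' 1 k 0 = if k = i then 1 else m 1 k 0) : GreedyInv E K T m' := by
  have hi : ∀ l, m 2 i l = 0 := fun l => by
    by_contra hl
    exact (h.mem i l hl).2 hsel
  have hGE : ∀ j ∈ G, j ∈ E i := fun j hj => (mem_filter.1 (hG hj)).1
  have hGp : ∀ j ∈ G, ∀ k, m 2 k j = 0 := fun j hj k => by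
    by_contra hk
    exact (h.price_iff j).2 ⟨k, hk⟩ (mem_filter.1 (hG hj)).2
  have hheld : ∀ k, held E m' k = if k = i then G else held E m k := by
    intro k
    ext l
    simp only [held, mem_filter, hgr.part]
    have := hi l
    have := hGE l
    grind [held]
  refine ⟨fun j => ?_, fun k k' j => ?_, fun k j => ?_, fun k hk => ?_, fun k hk => ?_,
    fun k hk => ?_⟩
  · rw [hgr.price]
    by_cases hj : j ∈ G
    · simp only [hj, if_true, ne_eq, one_ne_zero, not_false_eq_true, true_iff]
      exact ⟨i, by rw [hgr.part]; simp [hj]⟩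
    · simp only [hj, if_false, h.price_iff j, hgr.part, and_false]
  · rw [hgr.part, hgr.part]
    have := h.disj k k' j
    have := hGp j
    grind
  · rw [hgr.part, hs]
    have := h.mem k j
    have := hGE j
    grind
  · rw [hheld]
    split_ifs with hki
    · rwa [hki]
    · exact h.le k (by simpa [hs, hki] using hk)
  · rw [hheld]
    split_ifs with hki
    · rwa [hki]
    · exact h.lt k (by simpa [hs, hki] using hk)
  · rw [← h.small k hk, hs, if_neg (by rintro rfl; omega)]

open scoped Classical in
/-- If set number `i` has not been selected, then most of it is held by sets that are not larger. -/
def Blocked (E : ℕ → Finset ℕ) (K : ℕ) (m : ℕ → ℕ → ℕ → ℕ) (i : ℕ) : Prop :=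
  m 1 i 0 = 0 → K * (E i).card < K * ((E i).filter fun j =>
    ∃ t, m 2 t j ≠ 0 ∧ (E t).card ≤ (E i).card).card + (E i).card

/-- Parts only grow during the greedy phase, so occupied elements stay occupied by the same sets. -/
theorem Blocked.grabbed {m m' : ℕ → ℕ → ℕ → ℕ} {i k : ℕ} {G : Finset ℕ} (h : Blocked E K m k)
    (hgr : Grabbed i G m m') (hs : ∀ k, m' 1 k 0 = if k = i then 1 else m 1 k 0) :
    Blocked E K m' k := by
  classical
  intro hk
  rw [hs] at hk
  split_ifs at hk
  refine (h hk).trans_le (Nat.add_le_add_right (Nat.mul_le_mul_left _ (card_le_card ?_)) _)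
  refine monotone_filter_right _ fun j _ ⟨t, ht, hle⟩ => ⟨t, ?_, hle⟩
  rw [hgr.part]
  split_ifs
  · exact one_ne_zero
  · exact ht

/-- All sets selected so far are not larger than set number `i`, so every element that is not free
counts as blocking. -/
theorem blocked_of_few_free {T : Finset ℕ} {m : ℕ → ℕ → ℕ → ℕ} (h : GreedyInv E K T m) {i : ℕ}
    (hfree : K * ((E i).filter fun j => m 4 j 0 = 0).card < (E i).card)
    (hle : ∀ t, m 1 t 0 ≠ 0 → (E t).card ≤ (E i).card) : Blocked E K m i := by
  classical
  intro _
  have heq : ((E i).filter fun j => ∃ t, m 2 t j ≠ 0 ∧ (E t).card ≤ (E i).card) =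
      (E i).filter fun j => ¬ m 4 j 0 = 0 := by
    refine filter_congr fun j _ => ?_
    rw [← ne_eq, h.price_iff]
    exact exists_congr fun t => and_iff_left_of_imp fun ht => hle t (h.mem t j ht).2
  have hsum := card_filter_add_card_filter_not (s := E i) (fun j => m 4 j 0 = 0)
  rw [heq, ← hsum, Nat.mul_add]
  omega

/-- Set number `t` precedes set number `i` of size `q`. -/
def Before (E : ℕ → Finset ℕ) (q i t : ℕ) : Prop :=
  (E t).card < q ∨ (E t).card = q ∧ t < i

/-- The loops enumerate pairs (size, index) lexicographically; everything selected precedes the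
current pair, and every large set preceding it is selected or blocked. -/
theorem wp_greedyCmd {T : Finset ℕ} (h : Ctx E n N K B s) (hM : N ≤ M) (hM' : n ≤ M)
    (hKpos : 0 < K) (hn : ∀ i, (E i).Nonempty → i < n) (hinv : GreedyInv E K T s.mem)
    (hsmall : ∀ i, s.mem 1 i 0 ≠ 0 → (E i).card ≤ K) :
    WP (M * (M * (M * 43 + 105) + 10) + 5) greedyCmd s fun s' =>
      GreedyInv E K T s'.mem ∧ ∀ i, K < (E i).card → Blocked E K s'.mem i := by
  refine (WP.forTo (L := N) (M := M) (t := M * (M * 43 + 105) + 5)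
    (fun r s' => GreedyInv E K T s'.mem ∧
      (∀ t, s'.mem 1 t 0 ≠ 0 → Before E (r + K + 1) 0 t) ∧
      ∀ t, K < (E t).card → Before E (r + K + 1) 0 t → Blocked E K s'.mem t)
    h.hN h.one hM (by decide) (by decide) ?_ ?_ ?_ le_rfl).mono le_rfl ?_
  · intro k s v w hI
    exact hI
  · refine ⟨hinv, fun t ht => ?_, fun t ht hb => ?_⟩
    · have := hsmall t ht
      exact .inl (by omega)
    · unfold Before at hb
      omega
  · rintro r s₁ _ hr hm hr16 ⟨hI, hsel, hbl⟩
    have hc₁ : Ctx E n N K B s₁ := h.of_eq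
      (fun x hx => hr x (by interval_cases x <;> decide) (by omega) (by omega)) (hm 0 (by decide))
    refine (WP.forTo (L := n) (M := M) (t := M * 43 + 100)
      (fun i s' => GreedyInv E K T s'.mem ∧
        (∀ t, s'.mem 1 t 0 ≠ 0 → Before E (r + K + 1) i t) ∧
        ∀ t, K < (E t).card → Before E (r + K + 1) i t → Blocked E K s'.mem t)
      hc₁.hn hc₁.one hM' (by decide) (by decide) ?_ ?_ ?_ le_rfl).mono le_rfl ?_
    · intro k s v w hI
      exact hI
    · exact ⟨hI, hsel, hbl⟩
    · rintro i s₂ hin hr₂ hm₂ hi ⟨hI₂, hsel₂, hbl₂⟩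
      have hc₂ : Ctx E n N K B s₂ := hc₁.of_eq
        (fun x hx => hr₂ x (by interval_cases x <;> decide) (by omega) (by omega))
        (hm₂ 0 (by decide))
      have h16 : s₂.reg 16 = r := (hr₂ 16 (by decide) (by omega) (by omega)).trans hr16
      refine (wp_greedyStep hc₂ hM hKpos).mono le_rfl ?_
      rw [hi, h16]
      have hmono : ∀ t, Before E (r + K + 1) i t → Before E (r + K + 1) (i + 1) t :=
        fun t ht => ht.imp id fun h => ⟨h.1, by omega⟩
      have hcases : ∀ t, Before E (r + K + 1) (i + 1) t →
          Before E (r + K + 1) i t ∨ t = i ∧ (E i).card = r + K + 1 := by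
        rintro t (ht | ⟨ht, hti⟩)
        · exact .inl (.inl ht)
        · rcases Nat.lt_succ_iff_lt_or_eq.1 hti with hti | rfl
          · exact .inl (.inr ⟨ht, hti⟩)
          · exact .inr ⟨rfl, ht⟩
      rintro s₃ (⟨hmem, hne⟩ | ⟨hsize, ⟨hmem, hfree⟩ | ⟨G, hG, hle, hlt, hgr, hs⟩⟩)
      · rw [hmem]
        refine ⟨hI₂, fun t ht => hmono t (hsel₂ t ht), fun t hK ht => ?_⟩
        rcases hcases t ht with ht | ⟨_, ht⟩
        · exact hbl₂ t hK ht
        · exact absurd ht hne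
      · rw [hmem]
        refine ⟨hI₂, fun t ht => hmono t (hsel₂ t ht), fun t hK ht => ?_⟩
        rcases hcases t ht with ht | ⟨rfl, _⟩
        · exact hbl₂ t hK ht
        · refine blocked_of_few_free hI₂ hfree fun t' ht' => ?_
          rcases hsel₂ t' ht' with h' | h' <;> omega
      -- A selected set precedes the current pair, and the current set does not precede itself.
      · have hseli : s₂.mem 1 i 0 = 0 := by
          by_contra h'
          rcases hsel₂ i h' with h' | h' <;> omega
        refine ⟨hI₂.grabbed (by omega) hseli hG hle hlt hgr hs, fun t ht => ?_, fun t hK ht => ?_⟩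
        · by_cases hti : t = i
          · exact .inr ⟨hti ▸ hsize, by omega⟩
          · exact hmono t (hsel₂ t (by simpa [hs, hti] using ht))
        · rcases hcases t ht with ht | ⟨rfl, _⟩
          · exact (hbl₂ t hK ht).grabbed hgr hs
          · intro h'
            simp [hs] at h'
    · rintro s' ⟨hI', hsel', hbl'⟩
      refine ⟨hI', fun t ht => ?_, fun t hK ht => hbl' t hK ?_⟩
      · rcases hsel' t ht with h' | h' <;> exact .inl (by omega)
      -- Passing from the end of one size, index bound `n`, to the start of the next is harmless
      -- because large sets have index below `n`.
      · have htn : t < n := hn t (card_pos.1 (by omega))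
        unfold Before at ht ⊢
        omega
  · rintro s' ⟨hI, _, hbl⟩
    refine ⟨hI, fun t hK => hbl t hK (.inl ?_)⟩
    have := card_le_card (h.sub t)
    rw [card_range] at this
    omega

/-! ### The whole program -/

/-- A member of `I` is small, or large and selected (`L`), or large and rejected (`R`). The charge
for `R` may use all of `C`, small winners included, which costs one extra `|C|`. -/
theorem GreedyInv.bound {T : Finset ℕ} {m : ℕ → ℕ → ℕ → ℕ} (h : GreedyInv E K T m)
    (hK : K = 2 * (B + 1)) (hn : ∀ i, (E i).Nonempty → i < n)
    (hT : ∀ i ∈ T, i < n ∧ (E i).card ≤ K)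
    (hbl : ∀ i, K < (E i).card → Blocked E K m i) {I : Finset ℕ}
    (hsmall : B * (I.filter fun i => (E i).card ≤ K).card ≤ (B + 1) * T.card)
    (hdisj : (I : Set ℕ).PairwiseDisjoint E) : B * I.card ≤ (B + 2) * (chosen n m).card := by
  classical
  set C := chosen n m with hC
  set R := I.filter fun i => K < (E i).card ∧ m 1 i 0 = 0 with hR
  set L := C.filter fun i => K < (E i).card with hL
  have hTL : T.card + L.card ≤ C.card := by
    rw [← card_union_of_disjoint]
    · refine card_le_card (union_subset (fun i hi => ?_) (filter_subset _ _))
      exact mem_filter.2 ⟨mem_range.2 (hT i hi).1, (h.small i (hT i hi).2).2 hi⟩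
    · refine disjoint_left.2 fun i hi hi' => ?_
      have := (hT i hi).2
      have := (mem_filter.1 hi').2
      omega
  have hRC : B * R.card ≤ C.card := by
    refine greedy_charge (E := E) (A := held E m) hK
      (fun t ht => h.lt t (mem_filter.1 ht).2) (fun i hi => ?_)
      (hdisj.subset (by exact_mod_cast filter_subset _ _))
    obtain ⟨_, hiK, hi0⟩ := mem_filter.1 hi
    refine ⟨hiK, (hbl i hiK hi0).trans_le
      (Nat.add_le_add_right (Nat.mul_le_mul_left _ (card_le_card fun j hj => ?_)) _)⟩
    obtain ⟨hj, t, ht, hle⟩ := mem_filter.1 hj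
    refine mem_filter.2 ⟨hj, ?_⟩
    have hjt := h.mem t j ht
    exact ⟨t, mem_filter.2 ⟨mem_range.2 (hn t ⟨j, hjt.1⟩), hjt.2⟩, mem_filter.2 ⟨hjt.1, ht⟩, hle⟩
  have hI : I.card ≤ (I.filter fun i => (E i).card ≤ K).card + (L.card + R.card) := by
    refine le_trans (card_le_card ?_) ((card_union_le _ (L ∪ R)).trans
      (Nat.add_le_add_left (card_union_le _ _) _))
    intro i hi
    have hin : K < (E i).card → i < n := fun hlt => hn i (card_pos.1 (by omega))
    simp only [hL, hR, hC, chosen, mem_union, mem_filter, mem_range]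
    grind
  have := Nat.mul_le_mul_left B hI
  -- `B|I| ≤ (B+1)|T| + B|L| + |C| ≤ (B+1)|C| + |C|`.
  nlinarith

/-- A bound for the number of steps, as a polynomial in `n + N`. -/
noncomputable def timeBound (B : ℕ) : Polynomial ℕ :=
  .C (B * 6 + 40) +
    (1 + .C B * .X) * (.X * (.X * 24 + 105) + 10) + .X * (.X * (.X * 43 + 105) + 10)

theorem wp_packCmd (hn0 : s.reg 0 = n) (hN : s.reg 1 = N)
    (hinc : ∀ i j, s.mem 0 i j = if j ∈ E i then 1 else 0)
    (h0 : ∀ a i j, a ≠ 0 → s.mem a i j = 0) (hsub : ∀ i, E i ⊆ range N)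
    (hn : ∀ i, (E i).Nonempty → i < n) (hK : K = 2 * (B + 1)) :
    WP ((timeBound B).eval (n + N)) (packCmd K B) s fun s' => ∃ T, GreedyInv E K T s'.mem ∧
      ∀ I : Finset ℕ, (∀ i ∈ I, (E i).Nonempty) → (I : Set ℕ).PairwiseDisjoint E →
        B * I.card ≤ (B + 2) * (chosen n s'.mem).card := by
  set M := n + N with hM
  set a := (1 + B * M) * (M * (M * 24 + 105) + 10) with ha
  set b := M * (M * (M * 43 + 105) + 10) with hb
  have ht : (timeBound B).eval M = B * 6 + 40 + a + b := by
    simp [timeBound, ha, hb]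
  refine WP.seq (a := 1) (b := B * 6 + 38 + a + b) (WP.const le_rfl ?_) (by omega)
  refine WP.seq (a := 1) (b := B * 6 + 36 + a + b) (WP.const le_rfl ?_) (by omega)
  refine WP.seq (a := 1) (b := B * 6 + 34 + a + b) (WP.const le_rfl ?_) (by omega)
  refine WP.seq (a := 1) (b := B * 6 + 32 + a + b) (WP.const le_rfl ?_) (by omega)
  generalize hs₁ : State.setReg _ _ _ = s₁
  have hm₁ : s₁.mem = s.mem := by rw [← hs₁]; rfl
  have hc₁ : Ctx E n N K B s₁ := by
    constructor <;> first | assumption | rw [hm₁]; assumption | simp [← hs₁, setReg_reg, *]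
  refine WP.seq (a := B * 6 + 13 + a) (b := b + 5) ?_ (by omega)
  refine (wp_auctionCmd hc₁ (M := M) (by omega) (by omega)
    (by rw [hm₁]; exact h0)).frame.mono le_rfl ?_
  rintro s₂ ⟨⟨hA, hcont⟩, hf⟩
  have hc₂ : Ctx E n N K B s₂ := hc₁.of_eq
    (fun x hx => hf.reg x (by interval_cases x <;> decide)) (hf.mem 0 (by decide))
  have hsm : ∀ i, s₂.mem 1 i 0 ≠ 0 → (E i).card ≤ K := fun i hi => by
    obtain ⟨j, hj⟩ := (hA.sel_iff i).1 hi
    exact (hA.mem i j hj).2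
  refine (wp_greedyCmd hc₂ (M := M) (by omega) (by omega) (by omega) hn (hA.greedyInv hn)
    hsm).mono le_rfl ?_
  rintro s₃ ⟨hG, hbl⟩
  refine ⟨_, hG, fun I hne hdisj => hG.bound hK hn (fun i hi => ?_) hbl ?_ hdisj⟩
  · obtain ⟨hi, hi'⟩ := mem_filter.1 hi
    exact ⟨mem_range.1 hi, hsm i hi'⟩
  · exact hA.bound hn hcont (fun i hi => (mem_filter.1 hi).2)
      (fun i hi => hne i (mem_filter.1 hi).1)
      (hdisj.subset (by exact_mod_cast filter_subset _ _))

theorem packCmd_noFlip (K B : ℕ) : (packCmd K B).NoFlip := by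
  simp [packCmd, auctionCmd, greedyCmd, auctionStep, greedyStep, sizeCmd, cheapestCmd, buyCmd,
    countFreeCmd, grabCmd, forTo, Cmd.NoFlip]

/-- This makes the output constant in `ω`, so probability and expectation need no measurability
argument. -/
theorem final_packCmd_mem {n N : ℕ} (K B t : ℕ) (S : Fin n → Finset (Fin N)) (ω ω' : ℕ → Bool) :
    (final (packCmd K B) S t ω).mem = (final (packCmd K B) S t ω').mem := by
  have := iterate_step_coins ω t ⟨[packCmd K B], input S ω'⟩ (by simpa using packCmd_noFlip K B)
  exact congrArg (fun C => C.state.mem) this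

/-- The sets of the family as sets of numbers. -/
def natSet {n N : ℕ} (S : Fin n → Finset (Fin N)) (i : ℕ) : Finset ℕ :=
  if hi : i < n then (S ⟨i, hi⟩).map Fin.valEmbedding else ∅

theorem natSet_val {n N : ℕ} (S : Fin n → Finset (Fin N)) (i : Fin n) :
    natSet S i = (S i).map Fin.valEmbedding := by
  simp [natSet]

theorem packCmd_spec {n N : ℕ} (S : Fin n → Finset (Fin N)) (hK : K = 2 * (B + 1))
    (ω : ℕ → Bool) :
    (run (packCmd K B) (input S ω) ((timeBound B).eval (n + N))).code = [] ∧
    IsPartialPacking S (1 / K) (selected n (final (packCmd K B) S ((timeBound B).eval (n + N)) ω))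
      (fun i => part N (final (packCmd K B) S ((timeBound B).eval (n + N)) ω) i) ∧
    ∀ m, HasPartition S m → B * m ≤
      (B + 2) * (selected n (final (packCmd K B) S ((timeBound B).eval (n + N)) ω)).card := by
  have hlt : ∀ i, (natSet S i).Nonempty → i < n := by
    intro i hi
    by_contra h
    simp [natSet, h] at hi
  have hmem : ∀ (i : Fin n) (j : Fin N), (j : ℕ) ∈ natSet S i ↔ j ∈ S i := by
    intro i j
    rw [natSet_val]
    simp [Fin.val_inj]
  have hwp : WP ((timeBound B).eval (n + N)) (packCmd K B) (input S ω) _ :=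
    wp_packCmd (E := natSet S) (K := K) (n := n) (N := N) rfl rfl ?_ ?_ ?_ hlt hK
  · obtain ⟨hcode, T, hG, hbound⟩ := hwp.run
    change GreedyInv (natSet S) K T
      (final (packCmd K B) S ((timeBound B).eval (n + N)) ω).mem at hG
    change ∀ I : Finset ℕ, (∀ i ∈ I, (natSet S i).Nonempty) →
      (I : Set ℕ).PairwiseDisjoint (natSet S) → B * I.card ≤ (B + 2) *
        (chosen n (final (packCmd K B) S ((timeBound B).eval (n + N)) ω).mem).card at hbound
    refine ⟨hcode, ?_⟩
    generalize final (packCmd K B) S ((timeBound B).eval (n + N)) ω = s' at hG hbound ⊢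
    have hsel : chosen n s'.mem = (selected n s').map Fin.valEmbedding := by
      ext i
      simp only [chosen, selected, mem_filter, mem_range, mem_map, mem_univ, true_and,
        Fin.valEmbedding_apply]
      exact ⟨fun ⟨hi, h⟩ => ⟨⟨i, hi⟩, h, rfl⟩, fun ⟨x, h, hx⟩ => hx ▸ ⟨x.2, h⟩⟩
    have hpart : ∀ i : Fin n, part N s' i ⊆ S i := fun i j hj =>
      (hmem i j).1 (hG.mem i j (mem_filter.1 hj).2).1
    have hheld : ∀ i : Fin n, held (natSet S) s'.mem i = (part N s' i).map Fin.valEmbedding := by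
      intro i
      ext j
      simp only [held, part, mem_filter, mem_map, mem_univ, true_and, Fin.valEmbedding_apply]
      constructor
      · rintro ⟨hj, h⟩
        rw [natSet_val, mem_map] at hj
        obtain ⟨x, _, rfl⟩ := hj
        exact ⟨x, h, rfl⟩
      · rintro ⟨x, h, rfl⟩
        exact ⟨(hG.mem i x h).1, h⟩
    refine ⟨⟨fun i hi => ⟨hpart i, ?_⟩, ?_⟩, ?_⟩
    · have hle := hG.le i (mem_filter.1 hi).2
      rw [hheld, natSet_val, card_map, card_map] at hle
      rw [one_div, inv_mul_le_iff₀ (by exact_mod_cast (by omega : 0 < K))]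
      exact_mod_cast hle
    · intro i _ i' _ hne
      refine disjoint_left.2 fun j hj hj' => hne ?_
      exact Fin.val_injective (hG.disj i i' j (mem_filter.1 hj).2 (mem_filter.1 hj').2)
    · rintro _ ⟨I, rfl, hne, hdisj, _⟩
      have := hbound (I.map Fin.valEmbedding) ?_ ?_
      · rwa [hsel, card_map, card_map] at this
      · intro i hi
        obtain ⟨x, hx, rfl⟩ := mem_map.1 hi
        rw [Fin.valEmbedding_apply, natSet_val]
        exact (hne x hx).map
      · intro i hi i' hi' hii'
        obtain ⟨x, hx, rfl⟩ := mem_map.1 (mem_coe.1 hi)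
        obtain ⟨x', hx', rfl⟩ := mem_map.1 (mem_coe.1 hi')
        simp only [Function.onFun, Fin.valEmbedding_apply, natSet_val, disjoint_map]
        exact hdisj hx hx' fun h => hii' (congrArg _ h)
  · intro i j
    simp only [input, natSet]
    by_cases hi : i < n
    · by_cases hj : j < N
      · simp [hi, hj, Fin.exists_iff]
      · have : ∀ x : Fin N, (x : ℕ) ≠ j := fun x hx => hj (hx ▸ x.2)
        simp [hi, hj, this]
    · simp [hi]
  · intro a i j ha
    simp [input, ha]
  · intro i j hj
    by_cases hi : i < n
    · simp only [natSet, hi, dif_pos, mem_map, Fin.valEmbedding_apply] at hj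
      obtain ⟨x, _, rfl⟩ := hj
      simp
    · simp [natSet, hi] at hj

end SetPacking

/-! ### Choice of the parameters and the probabilistic conclusion -/

theorem theorem3 (δ : ℝ) (hδ : 0 < δ) :
    ∃ ε : ℝ, 0 < ε ∧ ∃ (P : RAM.Cmd) (p : Polynomial ℕ),
      ∀ (n N : ℕ) (S : Fin n → Finset (Fin N)),
        -- every run halts in polynomial time with a feasible output
        (∀ ω : ℕ → Bool,
          (RAM.run P (SetPacking.input S ω) (p.eval (n + N))).code = [] ∧
          SetPacking.IsPartialPacking S ε
            (SetPacking.selected n (SetPacking.final P S (p.eval (n + N)) ω))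
            (fun i => SetPacking.part N (SetPacking.final P S (p.eval (n + N)) ω) i)) ∧
        -- the number of selected sets is large, with constant probability and in expectation
        ∀ m : ℕ, SetPacking.HasPartition S m →
          2 / 3 ≤ RAM.fairCoins.real {ω : ℕ → Bool | (1 - δ) * (m : ℝ) ≤
            ((SetPacking.selected n (SetPacking.final P S (p.eval (n + N)) ω)).card : ℝ)} ∧
          (1 - δ) * (m : ℝ) ≤ ∫ ω : ℕ → Bool,
            ((SetPacking.selected n (SetPacking.final P S (p.eval (n + N)) ω)).card : ℝ)
              ∂(RAM.fairCoins) := by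
  -- `2 < δ * B` turns the factor `(B + 2) / B` into at most `1 + δ`.
  obtain ⟨B, hB⟩ := exists_nat_gt (2 / δ)
  have hBpos : (0 : ℝ) < B := (div_pos two_pos hδ).trans hB
  rw [div_lt_iff₀ hδ] at hB
  refine ⟨1 / ((2 * (B + 1) : ℕ) : ℝ), by positivity, SetPacking.packCmd (2 * (B + 1)) B,
    SetPacking.timeBound B, fun n N S => ⟨fun ω => ?_, fun m hm => ?_⟩⟩
  · have := SetPacking.packCmd_spec (B := B) S rfl ω
    exact ⟨this.1, this.2.1⟩
  set P := SetPacking.packCmd (2 * (B + 1)) B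
  set t := (SetPacking.timeBound B).eval (n + N)
  have hlarge : ∀ ω, (1 - δ) * (m : ℝ) ≤
      ((SetPacking.selected n (SetPacking.final P S t ω)).card : ℝ) := by
    intro ω
    have h := (SetPacking.packCmd_spec (B := B) S rfl ω).2.2 m hm
    set c := (SetPacking.selected n (SetPacking.final P S t ω)).card
    have h' : (B : ℝ) * m ≤ (B + 2) * c := by exact_mod_cast h
    have hc : (0 : ℝ) ≤ c := Nat.cast_nonneg c
    have hm0 : (0 : ℝ) ≤ m := Nat.cast_nonneg m
    have h1 : (m : ℝ) ≤ (1 + δ) * c := by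
      have : (B : ℝ) * m ≤ B * ((1 + δ) * c) := by nlinarith
      exact le_of_mul_le_mul_left this hBpos
    -- For `δ ≤ 1`, multiply by `1 - δ` and use `(1 - δ) * (1 + δ) ≤ 1`; for `δ ≥ 1` the left side
    -- is not positive.
    rcases le_total δ 1 with hδ1 | hδ1
    · nlinarith [mul_le_mul_of_nonneg_left h1 (sub_nonneg.2 hδ1), mul_nonneg (sq_nonneg δ) hc]
    · nlinarith [mul_nonneg (sub_nonneg.2 hδ1) hm0]
  have hconst : ∀ ω, SetPacking.selected n (SetPacking.final P S t ω) =
      SetPacking.selected n (SetPacking.final P S t fun _ => false) := fun ω => by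
    simp only [SetPacking.selected, P,
      SetPacking.final_packCmd_mem (2 * (B + 1)) B t S ω fun _ => false]
  constructor
  · simp only [hlarge, Set.ofPred_true, probReal_univ]
    norm_num
  · simp only [hconst, integral_const, probReal_univ, one_smul]
    exact hlarge _
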